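/- **Theorem 5 (oracle inequality).** Notation. $\Phi$ is the standard normal distribution function, $\log_+x=1\vee\log x$, $s_\lambda(x)=\mathrm{sgn}(x)(|x|-\lambda)_+$, $h_\lambda(x)=xI\{|x|>\lambda\}$, and $R(0,\lambda)=E\,s_\lambda(N(0,1))^2$. For $n\ge2$ let $X=(X_1,\dots,X_n)\sim N(\theta,I_n)$ under $P_\theta$, $\theta\in\mathbb R^n$, let $N(t)=\#\{i\le n:|X_i|\ge t\}$, $\xi_{j,k}=-\Phi^{-1}(\alpha_jk/(2n))$ for $j=1,2$, and $$\hat\xi_1=\min\{\xi_{1,k}:1\le k\le n,\ N(\xi_{1,k})\ge k\},\qquad \hat\xi_2=\max\{\xi_{2,k}:1\le k\le n,\ N(\xi_{2,k+1})<k+1\},$$ with $\hat\xi_1=\xi_{1,1}$ if no $k$ qualifies. Let $G_n$ be the uniform distribution on $\theta_1,\dots,\theta_n$. Let $0<\alpha_2'<\alpha_2\le\alpha_1<\alpha_1'<1$, $0<\beta_0\le1/2$, $A>0$ and $M_0$ be fixed constants, and let $n_*=\min\{m\ge2:1+m^{\beta_0-1/2}/2\le1/\alpha_1'\}$ ($\min\emptyset=\infty$).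 Let $0\le\delta_{1,n}\le\delta_{2,n}\wedge A$, with $1+\delta_{2,n}\le A$ whenever $n<n_*$. Let $g_{1,n}$ satisfy, for all $x>0$, $0\le g_{1,n}(x)\le x$, $0\le g_{1,n}'(x)\le M_0$ and $$R(0,g_{1,n}(x))\le\min\Big\{4\Phi(-x),\ \frac{M_0\Phi(-x)}{(x^{c_{1,n}}+2)(1\vee\log x)^{c_{2,n}}}\Big\},$$ where $0<c_{1,n}\le2$, $|c_{2,n}|\le M_0$, and $c_{2,n}\le0$ if $c_{1,n}=2$. Let $\hat\lambda$ be a random threshold level with $$\sqrt{1+\delta_{1,n}}\,g_{1,n}(\hat\xi_1)\le\hat\lambda\le\sqrt{1+\delta_{2,n}}\,\hat\xi_2 .$$ Let $t_\lambda$, $\lambda\ge0$, be threshold functions with $s_\lambda(x)\le t_\lambda(x)\le h_\lambda(x)$ for $x\ge0$, $h_\lambda(x)\le t_\lambda(x)\le s_\lambda(x)$ for $x<0$, $0\le t_\lambda(y)-t_\lambda(x)\le\kappa_0(y-x)$ for $x<y$, and $|t_\lambda(x)-t_{\lambda'}(x)|\le\kappa_1|\lambda-\lambda'|$, for constants $\kappa_0\in[1,2)$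 and $\kappa_1<\infty$; $t_\lambda$ is applied to vectors per component. Put $C_0=\kappa_0/(2-\kappa_0)$, $B_0=(8/\alpha_2')\vee(2C_0^2)$, and $$\eta^*=\eta^*_{G_n}=\min_{0\le\lambda\le\infty}\Big\{\rho_{G_n}(\lambda)+B_0\Phi(-\lambda)\Big\},\qquad \rho_{G_n}(\lambda)=\int(u^2\wedge\lambda^2)\,G_n(du).$$ Then $E_\theta\|t_{\hat\lambda}(X)-\theta\|^2<\infty$ and $$\sqrt{E_\theta\|t_{\hat\lambda}(X)-\theta\|^2/n}\ \le\ \sqrt{(1+\delta_{2,n})\eta^*}+M^*\sqrt{(1+\delta_{2,n})\tau_{1,n}^*\eta^*+\tau_{2,n}^*},$$ where $M^*$ is a constant depending only on $\{\alpha_1',\alpha_2',\beta_0,A,M_0\}$, and, with $L_{1,n}^*=e\vee\log(1/\eta^*)$, $$\tau_{1,n}^*=\max\Big(\frac{\log(e\vee\log n)}{1\vee\log n},\ \frac{(\log L_{1,n}^*)^{-c_{2,n}}}{(L_{1,n}^*)^{c_{1,n}/2}},\ \frac1{L_{1,n}^*}\Big),\qquad \tau_{2,n}^*=\frac{L_{2,n}}{n^{1+\delta_{1,n}}},$$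 $$L_{2,n}=(\log n)^{-3/2}\Big(\frac{\delta_{1,n}(\log n)^{(5-c_{1,n})/2}}{(\log_+\log n)^{c_{2,n}}}+\frac{(\log n)^{(3-c_{1,n})/2}}{(\log_+\log n)^{c_{2,n}-1}}\Big)^{1+\delta_{1,n}}.$$ (If $\eta^*=0$ then $\tau^*_{1,n}\eta^*$ is read as $0$.) -/

import Mathlib

open MeasureTheory ProbabilityTheory
open scoped ENNReal NNReal

noncomputable section

namespace FDRThreshold

/-- Standard normal distribution function `Φ`. -/
def Phi (t : ℝ) : ℝ := cdf (gaussianReal 0 1) t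

/-- Standard normal quantile function `Φ⁻¹(p)`, for `0 < p < 1`. -/
def PhiInv (p : ℝ) : ℝ := sInf {t : ℝ | p ≤ Phi t}

/-- `log₊ x = 1 ∨ log x`. -/
def logPlus (x : ℝ) : ℝ := max 1 (Real.log x)

/-- Soft threshold estimator `s_λ(x) = sgn(x)(|x| - λ)₊`. -/
def soft (lam x : ℝ) : ℝ := Real.sign x * max (|x| - lam) 0

open Classical in
/-- Hard threshold estimator `h_λ(x) = x I{|x| > λ}`. -/
def hard (lam x : ℝ) : ℝ := if lam < |x| then x else 0

/-- Risk of soft thresholding at a single normal mean,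
`R(u, λ) = E (s_λ(N(u,1)) - u)²`. -/
def softRisk (u lam : ℝ) : ℝ := ∫ x, (soft lam (x + u) - u) ^ 2 ∂(gaussianReal 0 1)

/-- Smooth threshold functions: between soft and hard thresholding, monotone and
`κ₀`-Lipschitz in the observation, `κ₁`-Lipschitz in the threshold level (levels are `≥ 0`).
Here `t lam x` is `t_λ(x)`. -/
structure IsSmoothThreshold (kappa0 kappa1 : ℝ) (t : ℝ → ℝ → ℝ) : Prop where
  one_le_kappa0 : 1 ≤ kappa0
  kappa0_lt_two : kappa0 < 2
  between_nonneg : ∀ lam x : ℝ, 0 ≤ lam → 0 ≤ x → soft lam x ≤ t lam x ∧ t lam x ≤ hard lam x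
  between_neg : ∀ lam x : ℝ, 0 ≤ lam → x < 0 → hard lam x ≤ t lam x ∧ t lam x ≤ soft lam x
  lipschitz_obs : ∀ lam x y : ℝ, 0 ≤ lam → x < y →
    0 ≤ t lam y - t lam x ∧ t lam y - t lam x ≤ kappa0 * (y - x)
  lipschitz_level : ∀ lam lam' x : ℝ, 0 ≤ lam → 0 ≤ lam' →
    |t lam x - t lam' x| ≤ kappa1 * |lam - lam'|

/-- Conditions on the function `g` in the lower bound for the threshold level. -/
structure LevelCondition (M0 c1 c2 : ℝ) (g : ℝ → ℝ) : Prop where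
  nonneg : ∀ x : ℝ, 0 < x → 0 ≤ g x
  le_self : ∀ x : ℝ, 0 < x → g x ≤ x
  differentiableAt : ∀ x : ℝ, 0 < x → DifferentiableAt ℝ g x
  deriv_nonneg : ∀ x : ℝ, 0 < x → 0 ≤ deriv g x
  deriv_le : ∀ x : ℝ, 0 < x → deriv g x ≤ M0
  risk_le : ∀ x : ℝ, 0 < x → softRisk 0 (g x) ≤
    min (4 * Phi (-x)) (M0 * Phi (-x) / ((x ^ c1 + 2) * (max 1 (Real.log x)) ^ c2))
  c1_pos : 0 < c1
  c1_le : c1 ≤ 2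
  abs_c2_le : |c2| ≤ M0
  c2_nonpos : c1 = 2 → c2 ≤ 0

/-- Candidate threshold levels `ξ_k = -Φ⁻¹(α k / (2n))`. -/
def xi (α : ℝ) (n k : ℕ) : ℝ := -PhiInv (α * k / (2 * n))

open Classical in
/-- `N(t)`: number of observations with `|x_i| ≥ t`. -/
def exceed {n : ℕ} (x : Fin n → ℝ) (t : ℝ) : ℕ :=
  (Finset.univ.filter fun i => t ≤ |x i|).card

/-- Step-up FDR level `min {ξ_k : 1 ≤ k ≤ n, N(ξ_k) ≥ k}`. It equals `ξ_1`, the largest candidate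
level, when no `k` qualifies (including `ξ_1` changes nothing in the other case). -/
def xiHat1 (α : ℝ) {n : ℕ} (x : Fin n → ℝ) : ℝ :=
  sInf ({xi α n 1} ∪ {s | ∃ k : ℕ, 1 ≤ k ∧ k ≤ n ∧ k ≤ exceed x (xi α n k) ∧ s = xi α n k})

/-- Step-down FDR level `max {ξ_k : 1 ≤ k ≤ n, N(ξ_{k+1}) < k + 1}`; `k = n` always qualifies. -/
def xiHat2 (α : ℝ) {n : ℕ} (x : Fin n → ℝ) : ℝ :=
  sSup {s | ∃ k : ℕ, 1 ≤ k ∧ k ≤ n ∧ exceed x (xi α n (k + 1)) < k + 1 ∧ s = xi α n k}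

/-- Empirical prior `G_n`: the uniform distribution on the coordinates of `θ`. -/
def empPrior {n : ℕ} (θ : Fin n → ℝ) : Measure ℝ :=
  (n : ℝ≥0∞)⁻¹ • ∑ i, Measure.dirac (θ i)

/-- `ρ_G(λ) = ∫ (u² ∧ λ²) G(du)`. -/
def rho (G : Measure ℝ) (lam : ℝ) : ℝ := ∫ u, min (u ^ 2) (lam ^ 2) ∂G

/-- Surrogate risk `r_G(λ) = ρ_G(λ) + B₀ Φ(-λ)`. -/
def surrogateRisk (B0 : ℝ) (G : Measure ℝ) (lam : ℝ) : ℝ := rho G lam + B0 * Phi (-lam)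

/-- `η*_G`: minimum of `r_G(λ)` over `λ ∈ [0, ∞]`, as an infimum over finite `λ ≥ 0`. -/
def etaStar (B0 : ℝ) (G : Measure ℝ) : ℝ :=
  sInf ((fun lam => surrogateRisk B0 G lam) '' Set.Ici 0)

/-- `n_* = min {m ≥ 2 : 1 + m^(β₀ - 1/2) / 2 ≤ 1 / α₁'}`, with `min ∅ = ∞`. -/
def nStar (β0 α1' : ℝ) : ℕ∞ :=
  ⨅ m ∈ {m : ℕ | 2 ≤ m ∧ 1 + (m : ℝ) ^ (β0 - 1 / 2) / 2 ≤ 1 / α1'}, (m : ℕ∞)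

/-- `L_{2,n}`. -/
def L2 (n : ℕ) (δ1 c1 c2 : ℝ) : ℝ :=
  (Real.log n) ^ (-(3 / 2) : ℝ) *
    (δ1 * (Real.log n) ^ ((5 - c1) / 2) / (logPlus (Real.log n)) ^ c2
      + (Real.log n) ^ ((3 - c1) / 2) / (logPlus (Real.log n)) ^ (c2 - 1)) ^ (1 + δ1)

/-- `τ*_{2,n} = L_{2,n} / n^(1 + δ₁)`. -/
def tau2 (n : ℕ) (δ1 c1 c2 : ℝ) : ℝ := L2 n δ1 c1 c2 / (n : ℝ) ^ (1 + δ1)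

/-- `L*_{1,n} = e ∨ log(1/η)`. -/
def L1 (η : ℝ) : ℝ := max (Real.exp 1) (Real.log (1 / η))

/-- `τ*_{1,n}`, as a function of `η = η*_{G_n}`. -/
def tau1 (n : ℕ) (η c1 c2 : ℝ) : ℝ :=
  max (max (Real.log (max (Real.exp 1) (Real.log n)) / max 1 (Real.log n))
      ((Real.log (L1 η)) ^ (-c2) / (L1 η) ^ (c1 / 2)))
    (1 / L1 η)

/-- Squared error `‖t_λ(x) - θ‖²`, with `t_λ` applied per component. -/
def sqError (t : ℝ → ℝ → ℝ) (lam : ℝ) {n : ℕ} (x θ : Fin n → ℝ) : ℝ :=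
  ∑ i, (t lam (x i) - θ i) ^ 2

end FDRThreshold

end

open MeasureTheory ProbabilityTheory FDRThreshold

open MeasureTheory ProbabilityTheory
open scoped ENNReal NNReal

noncomputable section

namespace FDRThreshold

-- Standard normal tails.

local notation "φ" => gaussianPDFReal 0 1

/-! Fix a near minimizer `lam` of the surrogate risk, and write z = x - θ. Coordinatewise, the error
of t_λ is at most min(|u|, B), the clipped bias at any level B ≥ λ, plus the soft-thresholded noise
2|s_λ(z)|, plus |z| on the few coordinates with |u| > `lam` (`abs_sub_mean_le`). Only κ₀ < 2 is
needed for this. Take B = √(1+δ₂) max(`lam`, ξ̂₂), replace λ in the noise by its lower bound, and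
bound three expectations.

Bias. Raising the level from `lam` to s costs at most 4 p(u,s) Φ(-lam)/Φ(-s), where p(u,s) is the
chance that N(u,1) exceeds s in absolute value (`min_sq_max_le`). At s = ξ_k the sum of these costs
is 8n/α Φ(-lam) μ_k/k, where μ_k is the mean number of exceedances. The step-down index satisfies
N(ξ_k) ≤ k, so by Chernoff μ_k/k is bounded in expectation (`integral_biasMajorant_le`).

Near minimizer. Moving `lam` to `lam` + 1/`lam` at least halves Φ(-lam) and raises ρ by at most 3
times the fraction of means beyond `lam`, itself O(η*/L₁) up to slack. Minimality then forces
Φ(-lam) = O(η*/L₁) up to slack (`exists_near_minimizer`).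

Noise. A step-up index k > 1 satisfies N(ξ_k) ≥ k. With y = η* ∨ 1/n and k well above ny, the mean
of N(ξ_k) is at most γk with γ < 1, so such k have exponentially small weight, while the noise risk
at ξ_k grows only polynomially in k/(ny). Hence the noise is of the order of its value at k ≈ ny:
nτ₁η* if η* ≥ 1/n, and nτ₂ otherwise (`exists_noise_majorant`).

The square is split with free weights 1+e and 1+1/e; optimizing e after integration turns the bounds
into a sum of square roots, which keeps the leading constant 1. -/

lemma stdPDF_eq (t : ℝ) : φ t = (√(2 * Real.pi))⁻¹ * Real.exp (-(t ^ 2 / 2)) := by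
  simp [gaussianPDFReal_def]
  left; ring

lemma stdPDF_neg (t : ℝ) : φ (-t) = φ t := by simp [stdPDF_eq]

lemma stdPDF_add (t b : ℝ) : φ (t + b) = φ t * Real.exp (-(t * b) - b ^ 2 / 2) := by
  rw [stdPDF_eq, stdPDF_eq, mul_assoc, ← Real.exp_add]
  ring_nf

lemma stdPDF_nonneg (t : ℝ) : 0 ≤ φ t := gaussianPDFReal_nonneg _ _ _

lemma integrable_stdPDF : Integrable φ := integrable_gaussianPDFReal 0 1

lemma gaussianReal_real_eq_setIntegral (u : ℝ) (s : Set ℝ) :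
    (gaussianReal u 1).real s = ∫ t in s, gaussianPDFReal u 1 t := by
  rw [measureReal_def, gaussianReal_apply_eq_integral u one_ne_zero,
    ENNReal.toReal_ofReal (integral_nonneg fun t => gaussianPDFReal_nonneg _ _ _)]

lemma Phi_eq_real (x : ℝ) : Phi x = (gaussianReal 0 1).real (Set.Iic x) :=
  cdf_eq_real (μ := gaussianReal 0 1) x

lemma Phi_neg_eq_integral (x : ℝ) : Phi (-x) = ∫ t in Set.Ioi x, φ t := by
  rw [Phi_eq_real, gaussianReal_real_eq_setIntegral, ← integral_comp_neg_Ioi]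
  simp [stdPDF_neg]

lemma Phi_mono : Monotone Phi := monotone_cdf _

lemma Phi_nonneg (x : ℝ) : 0 ≤ Phi x := cdf_nonneg _ _

lemma Phi_le_one (x : ℝ) : Phi x ≤ 1 := cdf_le_one _ _

lemma Phi_neg_add (a b : ℝ) : Phi (-(a + b)) = ∫ t in Set.Ioi a, φ (t + b) := by
  have := (measurePreserving_add_right volume b).setIntegral_preimage_emb
    (measurableEmbedding_addRight b) (fun t => φ t) (Set.Ioi (a + b))
  rw [Phi_neg_eq_integral, ← this]
  simp

lemma Phi_add_Phi_neg (x : ℝ) : Phi x + Phi (-x) = 1 := by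
  rw [Phi_neg_eq_integral, Phi_eq_real, ← gaussianReal_real_eq_setIntegral, ← Set.compl_Iic]
  rw [probReal_compl_eq_one_sub measurableSet_Iic]
  ring

lemma Phi_zero : Phi 0 = 1 / 2 := by
  have := Phi_add_Phi_neg 0
  simp at this; linarith

/-- Integrate the density over (x, x+1] only, where t²/2 ≤ x² + 1. The exponent x² is not sharp, but
it suffices for the logarithmic comparisons below. -/
lemma Phi_neg_lower (x : ℝ) (hx : 0 ≤ x) :
    (√(2 * Real.pi))⁻¹ * Real.exp (-1) * Real.exp (-x ^ 2) ≤ Phi (-x) := by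
  have h1 : ∀ t ∈ Set.Ioc x (x + 1), (√(2 * Real.pi))⁻¹ * Real.exp (-1) * Real.exp (-x ^ 2) ≤ φ t := by
    intro t ht
    rw [stdPDF_eq, mul_assoc, ← Real.exp_add]
    gcongr
    nlinarith [ht.1, ht.2, sq_nonneg (x - 1)]
  rw [Phi_neg_eq_integral]
  calc _ = ∫ t in Set.Ioc x (x + 1), (√(2 * Real.pi))⁻¹ * Real.exp (-1) * Real.exp (-x ^ 2) := by
        simp
    _ ≤ ∫ t in Set.Ioc x (x + 1), φ t :=
        setIntegral_mono_on (integrableOn_const (by simp)) integrable_stdPDF.integrableOn measurableSet_Ioc h1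
    _ ≤ _ := setIntegral_mono_set integrable_stdPDF.integrableOn
        (ae_of_all _ stdPDF_nonneg) (Filter.Eventually.of_forall fun t ht => ht.1)

lemma Phi_pos (x : ℝ) : 0 < Phi x := by
  have h : 0 < Phi (-|x|) := lt_of_lt_of_le (by positivity) (Phi_neg_lower |x| (abs_nonneg x))
  exact h.trans_le (Phi_mono (neg_abs_le x))

lemma Phi_neg_add_le (a b : ℝ) (hb : 0 ≤ b) :
    Phi (-(a + b)) ≤ Real.exp (-(a * b) - b ^ 2 / 2) * Phi (-a) := by
  rw [Phi_neg_add, Phi_neg_eq_integral, ← integral_const_mul]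
  refine setIntegral_mono_on (integrable_stdPDF.comp_add_right b).integrableOn
    (integrable_stdPDF.const_mul _).integrableOn measurableSet_Ioi fun t ht => ?_
  rw [stdPDF_add, mul_comm]
  have : a * b ≤ t * b := mul_le_mul_of_nonneg_right (le_of_lt ht) hb
  gcongr
  exact stdPDF_nonneg t

lemma Phi_neg_le_of_le {a u : ℝ} (h : a ≤ u) :
    Phi (-u) ≤ Real.exp (-((u ^ 2 - a ^ 2) / 2)) * Phi (-a) := by
  have := Phi_neg_add_le a (u - a) (by linarith)
  rw [show a + (u - a) = u by ring] at this
  convert this using 3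
  ring

lemma Phi_neg_upper (x : ℝ) (hx : 0 ≤ x) : Phi (-x) ≤ Real.exp (-(x ^ 2 / 2)) / 2 := by
  have := Phi_neg_le_of_le hx
  rw [neg_zero, Phi_zero] at this
  convert this using 1
  ring_nf

/-- The two-sided normal tail is submultiplicative. -/
lemma Phi_neg_add_le_mul (a b : ℝ) (ha : 0 ≤ a) (hb : 0 ≤ b) :
    Phi (-(a + b)) ≤ 2 * Phi (-a) * Phi (-b) := by
  set w : ℝ := Real.exp (-(a * b) - b ^ 2 / 2)
  have hI : ∀ s : Set ℝ, IntegrableOn (fun t => φ (t + b)) s := fun s =>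
    (integrable_stdPDF.comp_add_right b).integrableOn
  have hJ : ∀ s : Set ℝ, IntegrableOn φ s := fun s => integrable_stdPDF.integrableOn
  have hU : Set.Ioc 0 a ∪ Set.Ioi a = Set.Ioi 0 := Set.Ioc_union_Ioi_eq_Ioi ha
  have hd : Disjoint (Set.Ioc 0 a) (Set.Ioi a) := Set.Ioc_disjoint_Ioi le_rfl
  have e1 : Phi (-b) = (∫ t in Set.Ioc 0 a, φ (t + b)) + Phi (-(a + b)) := by
    rw [Phi_neg_add, ← setIntegral_union hd measurableSet_Ioi (hI _) (hI _), hU, ← Phi_neg_add]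
    simp
  have e2 : (1 / 2 : ℝ) = (∫ t in Set.Ioc 0 a, φ t) + Phi (-a) := by
    rw [Phi_neg_eq_integral, ← setIntegral_union hd measurableSet_Ioi (hJ _) (hJ _), hU,
      ← Phi_neg_eq_integral]
    simp [Phi_zero]
  -- The ratio φ(t+b)/φ(t) decreases in t and equals w at t = a, so it is at least w before a and at
  -- most w after. Cross-multiplying the two integrated bounds gives the claim.
  have i1 : w * (∫ t in Set.Ioc 0 a, φ t) ≤ ∫ t in Set.Ioc 0 a, φ (t + b) := by
    rw [← integral_const_mul]
    refine setIntegral_mono_on ((hJ _).const_mul _) (hI _) measurableSet_Ioc fun t ht => ?_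
    rw [stdPDF_add, mul_comm]
    have : t * b ≤ a * b := mul_le_mul_of_nonneg_right ht.2 hb
    exact mul_le_mul_of_nonneg_left (Real.exp_le_exp.2 (by linarith)) (stdPDF_nonneg t)
  have i2 : Phi (-(a + b)) ≤ w * Phi (-a) := Phi_neg_add_le a b hb
  have p1 : 0 ≤ ∫ t in Set.Ioc 0 a, φ t := integral_nonneg stdPDF_nonneg
  have k1 := mul_le_mul_of_nonneg_right i2 p1
  have k2 := mul_le_mul_of_nonneg_right i1 (Phi_nonneg (-a))
  have e3 : Phi (-(a + b)) = 2 * Phi (-(a + b)) * (1 / 2) := by ring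
  rw [e3, e1, e2]
  linarith

lemma Phi_continuous : Continuous Phi := by
  have h : ∀ x, Phi x = 1 - Phi (-x) := fun x => by linarith [Phi_add_Phi_neg x]
  have h2 : ∀ x, Phi (-x) = Phi 0 - ∫ t in (0:ℝ)..x, φ t := by
    intro x
    have := intervalIntegral.integral_Ioi_sub_Ioi' (f := φ) (a := 0) (b := x) (μ := volume) integrable_stdPDF.integrableOn
      integrable_stdPDF.integrableOn
    rw [← this, ← Phi_neg_eq_integral, ← Phi_neg_eq_integral]
    simp
  have : Phi = fun x => 1 - (Phi 0 - ∫ t in (0:ℝ)..x, φ t) := by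
    funext x; rw [h x, h2 x]
  rw [this]
  have := intervalIntegral.continuous_primitive (fun a b => integrable_stdPDF.intervalIntegrable (a := a) (b := b)) 0
  fun_prop

/-! ### Exceedance probabilities and the cost of raising the level. -/

/-- Probability that a normal variable with mean `u` exceeds `s` in absolute value. -/
def exceedProb (u s : ℝ) : ℝ := (gaussianReal u 1).real {x | s ≤ |x|}

lemma measurableSet_exceed (s : ℝ) : MeasurableSet {x : ℝ | s ≤ |x|} :=
  measurableSet_le measurable_const measurable_id.abs

lemma exceedProb_nonneg (u s : ℝ) : 0 ≤ exceedProb u s := measureReal_nonneg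

lemma exceedProb_le_one (u s : ℝ) : exceedProb u s ≤ 1 := measureReal_le_one

lemma gaussianReal_real_eq_shift (u : ℝ) (s : Set ℝ) (hs : MeasurableSet s) :
    (gaussianReal u 1).real s = (gaussianReal 0 1).real {x | x + u ∈ s} := by
  have := gaussianReal_map_add_const (μ := 0) (v := 1) u
  rw [zero_add] at this
  rw [← this, map_measureReal_apply (by fun_prop) hs]
  rfl

lemma exceedProb_neg (u s : ℝ) : exceedProb (-u) s = exceedProb u s := by
  unfold exceedProb
  rw [← gaussianReal_map_neg, map_measureReal_apply (by fun_prop) (measurableSet_exceed s)]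
  congr 1; ext x; simp

lemma Phi_sub_le_exceedProb (u s : ℝ) : Phi (|u| - s) ≤ exceedProb u s := by
  wlog hu : 0 ≤ u generalizing u
  · rw [← exceedProb_neg, ← abs_neg]; exact this _ (by linarith)
  rw [abs_of_nonneg hu]
  have h : (gaussianReal u 1).real (Set.Ioi s) ≤ exceedProb u s :=
    measureReal_mono fun x hx => (le_of_lt hx).trans (le_abs_self x)
  refine le_trans (le_of_eq ?_) h
  rw [gaussianReal_real_eq_shift u _ measurableSet_Ioi, gaussianReal_real_eq_setIntegral,
    show u - s = -(s - u) by ring, Phi_neg_eq_integral]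
  congr 2; ext x; simp [sub_lt_iff_lt_add]

lemma one_sub_exceedProb (u s : ℝ) (hs : 0 ≤ s) :
    1 - exceedProb u s = ∫ x in (-s)..s, φ (x + u) := by
  have h : {x : ℝ | s ≤ |x|}ᶜ = Set.Ioo (-s) s := by
    ext x; simp [abs_lt]
  rw [exceedProb, ← probReal_compl_eq_one_sub (measurableSet_exceed s), h,
    gaussianReal_real_eq_setIntegral, ← integral_Ioc_eq_integral_Ioo,
    ← intervalIntegral.integral_of_le (by linarith)]
  have h2 : ∀ x, gaussianPDFReal u 1 x = φ (x - u) := fun x => by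
    simp [gaussianPDFReal_def]
  simp_rw [h2]
  have h3 := intervalIntegral.integral_comp_neg (a := -s) (b := s) (fun x => φ (x - u))
  rw [neg_neg] at h3
  rw [← h3]
  congr 1; ext x
  rw [← stdPDF_neg]; ring_nf

lemma integral_stdPDF_symm (s : ℝ) : ∫ x in (-s)..s, φ x = 1 - 2 * Phi (-s) := by
  have := intervalIntegral.integral_Ioi_sub_Ioi' (f := φ) (a := -s) (b := s) (μ := volume)
    integrable_stdPDF.integrableOn integrable_stdPDF.integrableOn
  rw [← this, ← Phi_neg_eq_integral, ← Phi_neg_eq_integral, neg_neg]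
  linarith [Phi_add_Phi_neg s]

/-- Averaging over ±u turns the shifted density into φ(x) e^{-u²/2} cosh(xu), and cosh ≥ 1. So the
non-exceedance probability shrinks by at most the factor e^{-u²/2} ≥ 1 - u²/2 relative to u = 0. -/
lemma exceedProb_le (u s : ℝ) (hs : 0 ≤ s) :
    exceedProb u s ≤ 2 * Phi (-s) + min (u ^ 2) 1 := by
  have hI : ∀ v : ℝ, IntervalIntegrable (fun x => φ (x + v)) volume (-s) s := fun v =>
    (integrable_stdPDF.comp_add_right v).intervalIntegrable
  have hK : ∫ x in (-s)..s, φ (x + u) = ∫ x in (-s)..s, φ (x + -u) := by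
    rw [← one_sub_exceedProb u s hs, ← one_sub_exceedProb (-u) s hs, exceedProb_neg]
  have h1 : Real.exp (-(u ^ 2 / 2)) * (1 - 2 * Phi (-s)) ≤ 1 - exceedProb u s := by
    have e : 1 - exceedProb u s = ∫ x in (-s)..s, (φ (x + u) + φ (x + -u)) / 2 := by
      rw [intervalIntegral.integral_div, intervalIntegral.integral_add (hI _) (hI _), ← hK,
        one_sub_exceedProb u s hs]
      ring
    rw [e, ← integral_stdPDF_symm s, ← intervalIntegral.integral_const_mul]
    refine intervalIntegral.integral_mono_on (by linarith)
      (integrable_stdPDF.intervalIntegrable.const_mul _) (((hI _).add (hI _)).div_const 2)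
      fun x _ => ?_
    have c := Real.one_le_cosh (x * u)
    rw [Real.cosh_eq] at c
    rw [stdPDF_add, stdPDF_add, show -(x * u) - u ^ 2 / 2 = -(x * u) + -(u ^ 2 / 2) by ring,
      show -(x * -u) - (-u) ^ 2 / 2 = x * u + -(u ^ 2 / 2) by ring, Real.exp_add, Real.exp_add]
    have p : 0 ≤ φ x * Real.exp (-(u ^ 2 / 2)) := mul_nonneg (stdPDF_nonneg x) (Real.exp_nonneg _)
    nlinarith [mul_le_mul_of_nonneg_left c p]
  have h2 := Real.add_one_le_exp (-(u ^ 2 / 2))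
  have h3 := Phi_nonneg (-s)
  have h4 : Phi (-s) ≤ 1 / 2 := by rw [← Phi_zero]; exact Phi_mono (by linarith)
  have h5 := exceedProb_le_one u s
  rw [← min_add_add_left]
  refine le_min ?_ (by linarith)
  nlinarith [sq_nonneg u, mul_le_mul_of_nonneg_right h2 (by linarith : 0 ≤ 1 - 2 * Phi (-s))]

/-- Only |u| > lam and s > lam matter. Gaussian decay gives w² - lam² ≤ 2Φ(-lam)/Φ(-w) for w ≥ lam.
If |u| ≤ s, take w = |u| and use submultiplicativity, Φ(-s) ≤ 2Φ(-(s-|u|))Φ(-|u|), whose first tail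
is at most `exceedProb u s`. If |u| ≥ s, take w = s; the exceedance probability is then at least
1/2. -/
lemma min_sq_max_le (u lam s : ℝ) (hl : 0 ≤ lam) :
    min (u ^ 2) ((max lam s) ^ 2) ≤
      min (u ^ 2) (lam ^ 2) + 4 * exceedProb u s * (Phi (-lam) / Phi (-s)) := by
  have hnn : 0 ≤ 4 * exceedProb u s * (Phi (-lam) / Phi (-s)) :=
    mul_nonneg (mul_nonneg (by norm_num) (exceedProb_nonneg u s))
      (div_nonneg (Phi_nonneg _) (Phi_nonneg _))
  rcases le_total s lam with h | h
  · rw [max_eq_left h]; linarith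
  rw [max_eq_right h]
  rw [← sq_abs u] at *
  have hp := Phi_sub_le_exceedProb u s
  have hu0 := abs_nonneg u
  set v := |u|
  have hQs := Phi_pos (-s)
  have key : ∀ w, lam ≤ w → w ^ 2 - lam ^ 2 ≤ 2 * (Phi (-lam) / Phi (-w)) := by
    intro w hw
    have h1 := Phi_neg_le_of_le hw
    have h2 := Real.add_one_le_exp ((w ^ 2 - lam ^ 2) / 2)
    have h3 : Real.exp ((w ^ 2 - lam ^ 2) / 2) ≤ Phi (-lam) / Phi (-w) := by
      rw [le_div_iff₀ (Phi_pos _)]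
      calc _ ≤ Real.exp ((w ^ 2 - lam ^ 2) / 2) *
            (Real.exp (-((w ^ 2 - lam ^ 2) / 2)) * Phi (-lam)) := by gcongr
        _ = _ := by rw [← mul_assoc, ← Real.exp_add]; simp
    linarith
  rcases le_total v lam with h1 | h1
  · have : v ^ 2 ≤ lam ^ 2 := by gcongr
    rw [min_eq_left this]
    exact (min_le_left _ _).trans (by linarith)
  have h1' : lam ^ 2 ≤ v ^ 2 := by gcongr
  rw [min_eq_right h1']
  rcases le_total v s with h2 | h2
  · refine (min_le_left _ _).trans ?_
    have k := key v h1
    have sub := Phi_neg_add_le_mul (s - v) v (by linarith) hu0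
    rw [show s - v + v = s by ring, show -(s - v) = v - s by ring] at sub
    have : Phi (-lam) / Phi (-v) ≤ 2 * exceedProb u s * (Phi (-lam) / Phi (-s)) := by
      rw [← mul_div_assoc, div_le_div_iff₀ (Phi_pos _) hQs]
      have a1 : Phi (-s) ≤ 2 * exceedProb u s * Phi (-v) :=
        sub.trans (by have := Phi_nonneg (-v); gcongr)
      nlinarith [mul_le_mul_of_nonneg_left a1 (Phi_nonneg (-lam))]
    linarith
  · refine (min_le_right _ _).trans ?_
    have k := key s h
    have : 1 / 2 ≤ exceedProb u s := by
      rw [← Phi_zero]; exact (Phi_mono (by linarith)).trans hp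
    have q := div_nonneg (Phi_nonneg (-lam)) (Phi_nonneg (-s))
    nlinarith [mul_le_mul_of_nonneg_right this q]

/-! ### Normal quantiles and the random FDR indices. -/

lemma Phi_PhiInv (p : ℝ) (h0 : 0 < p) (h1 : p < 1) : Phi (PhiInv p) = p := by
  obtain ⟨b, hb⟩ := ((tendsto_cdf_atBot (gaussianReal 0 1)).eventually_lt_const h0).exists
  obtain ⟨c, hc⟩ := ((tendsto_cdf_atTop (gaussianReal 0 1)).eventually_const_lt h1).exists
  obtain ⟨t, ht⟩ := mem_range_of_exists_le_of_exists_ge Phi_continuous ⟨b, hb.le⟩ ⟨c, hc.le⟩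
  have hbdd : BddBelow {t : ℝ | p ≤ Phi t} := ⟨b, fun s hs => by
    by_contra! hlt
    exact absurd (hs.trans (Phi_mono hlt.le)) (not_le.2 hb)⟩
  have hmem : PhiInv p ∈ {t : ℝ | p ≤ Phi t} :=
    (isClosed_le continuous_const Phi_continuous).csInf_mem ⟨t, ht.ge⟩ hbdd
  refine le_antisymm ?_ hmem
  exact (Phi_mono (csInf_le hbdd ht.ge)).trans ht.le

lemma Phi_neg_xi {α : ℝ} (h0 : 0 < α) (h1 : α < 1) {n k : ℕ} (hk : 1 ≤ k) (hkn : k ≤ 2 * n) :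
    Phi (-xi α n k) = α * k / (2 * n) := by
  have hk' : (1 : ℝ) ≤ k := by exact_mod_cast hk
  have hkn' : (k : ℝ) ≤ 2 * n := by exact_mod_cast hkn
  rw [xi, neg_neg, Phi_PhiInv]
  · apply div_pos <;> nlinarith
  · rw [div_lt_one (by linarith)]; nlinarith

lemma xi_pos {α : ℝ} (h0 : 0 < α) (h1 : α < 1) {n k : ℕ} (hk : 1 ≤ k) (hkn : k ≤ n) :
    0 < xi α n k := by
  by_contra! h
  have := Phi_mono (neg_nonneg.2 h)
  rw [Phi_zero, Phi_neg_xi h0 h1 hk (by omega)] at this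
  have hk' : (1 : ℝ) ≤ k := by exact_mod_cast hk
  have hkn' : (k : ℝ) ≤ n := by exact_mod_cast hkn
  rw [le_div_iff₀ (by linarith)] at this
  nlinarith

lemma xi_anti {α : ℝ} (h0 : 0 < α) (h1 : α < 1) {n j k : ℕ} (hj : 1 ≤ j) (hjk : j ≤ k)
    (hkn : k ≤ 2 * n) : xi α n k ≤ xi α n j := by
  by_contra! h
  have := Phi_mono (neg_le_neg h.le)
  rw [Phi_neg_xi h0 h1 hj (by omega), Phi_neg_xi h0 h1 (by omega) hkn] at this
  rcases hjk.eq_or_lt with rfl | hlt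
  · exact lt_irrefl _ h
  have hn : (1 : ℝ) ≤ n := by exact_mod_cast (by omega : 1 ≤ n)
  have hlt' : (j : ℝ) < k := by exact_mod_cast hlt
  rw [div_le_div_iff_of_pos_right (by positivity)] at this
  nlinarith

lemma exceed_anti {n : ℕ} (x : Fin n → ℝ) : Antitone (exceed x) := fun s t h =>
  Finset.card_le_card fun i hi => by
    simp only [Finset.mem_filter] at hi ⊢
    exact ⟨hi.1, h.trans hi.2⟩

lemma exceed_le {n : ℕ} (x : Fin n → ℝ) (s : ℝ) : exceed x s ≤ n :=
  (Finset.card_filter_le _ _).trans (by simp)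

/-- The candidate set is finite, so the infimum is attained. The alternative k = 1 covers the
default level, which carries no exceedance information. -/
lemma xiHat1_mem (α : ℝ) {n : ℕ} (hn : 1 ≤ n) (x : Fin n → ℝ) :
    ∃ k : ℕ, 1 ≤ k ∧ k ≤ n ∧ (k = 1 ∨ k ≤ exceed x (xi α n k)) ∧ xiHat1 α x = xi α n k := by
  set S : Set ℝ := {xi α n 1} ∪ {s | ∃ k : ℕ, 1 ≤ k ∧ k ≤ n ∧ k ≤ exceed x (xi α n k) ∧ s = xi α n k}
  have hfin : S.Finite := by
    refine ((Finset.Icc 1 n).finite_toSet.image (xi α n)).subset ?_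
    rintro s (rfl | ⟨k, h1, h2, -, rfl⟩)
    · exact ⟨1, by simp [hn], rfl⟩
    · exact ⟨k, by simp [h1, h2], rfl⟩
  have hmem : xiHat1 α x ∈ S := Set.Nonempty.csInf_mem ⟨_, Or.inl rfl⟩ hfin
  rcases hmem with h | ⟨k, h1, h2, h3, h4⟩
  · exact ⟨1, le_rfl, hn, Or.inl rfl, h⟩
  · exact ⟨k, h1, h2, Or.inr h3, h4⟩

lemma xiHat2_mem {α : ℝ} (h0 : 0 < α) (h1 : α < 1) {n : ℕ} (hn : 1 ≤ n) (x : Fin n → ℝ) :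
    ∃ k : ℕ, 1 ≤ k ∧ k ≤ n ∧ exceed x (xi α n k) ≤ k ∧ xiHat2 α x = xi α n k := by
  set S : Set ℝ := {s | ∃ k : ℕ, 1 ≤ k ∧ k ≤ n ∧ exceed x (xi α n (k + 1)) < k + 1 ∧ s = xi α n k}
  have hfin : S.Finite := by
    refine ((Finset.Icc 1 n).finite_toSet.image (xi α n)).subset ?_
    rintro s ⟨k, h1, h2, -, rfl⟩
    exact ⟨k, by simp [h1, h2], rfl⟩
  have hmem : xiHat2 α x ∈ S :=
    Set.Nonempty.csSup_mem ⟨xi α n n, n, hn, le_rfl, Nat.lt_succ_of_le (exceed_le x _), rfl⟩ hfin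
  obtain ⟨k, h2, h3, h4, h5⟩ := hmem
  refine ⟨k, h2, h3, ?_, h5⟩
  -- The definition controls the count at ξ_{k+1} ≤ ξ_k. For k = n the index n + 1 is still at most
  -- 2n, so the quantile argument stays below 1.
  exact (exceed_anti x (xi_anti h0 h1 h2 (Nat.le_succ k) (by omega))).trans (Nat.le_of_lt_succ h4)

/-! ### Exponential moments of the number of exceedances. -/

/-- Indicator of `s ≤ |y|`. -/
def exceedInd (s y : ℝ) : ℝ := {y : ℝ | s ≤ |y|}.indicator 1 y

lemma measurable_exceedInd (s : ℝ) : Measurable (exceedInd s) :=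
  measurable_const.indicator (measurableSet_exceed s)

lemma exceedInd_le_one (s y : ℝ) : exceedInd s y ≤ 1 :=
  Set.indicator_le_self' (fun _ _ => zero_le_one) y

lemma exceed_eq_sum {n : ℕ} (x : Fin n → ℝ) (s : ℝ) :
    (exceed x s : ℝ) = ∑ i, exceedInd s (x i) := by
  classical
  simp [exceed, exceedInd, Set.indicator_apply]

lemma measurable_exceed {n : ℕ} (s : ℝ) : Measurable fun x : Fin n → ℝ => exceed x s := by
  have h : Measurable fun x : Fin n → ℝ => (exceed x s : ℝ) := by
    simp_rw [exceed_eq_sum]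
    exact Finset.measurable_sum _ fun _ _ => (measurable_exceedInd s).comp (measurable_pi_apply _)
  have : (fun x : Fin n → ℝ => exceed x s) = fun x => ⌊(exceed x s : ℝ)⌋₊ := by
    ext x; simp
  rw [this]
  exact Nat.measurable_floor.comp h

/-- The law of the observations. -/
abbrev obsLaw {n : ℕ} (θ : Fin n → ℝ) : Measure (Fin n → ℝ) :=
  Measure.pi fun i => gaussianReal (θ i) 1

/-- Expected number of observations with `|x_i| ≥ s`. -/
def meanExceed {n : ℕ} (θ : Fin n → ℝ) (s : ℝ) : ℝ := ∑ i, exceedProb (θ i) s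

lemma meanExceed_nonneg {n : ℕ} (θ : Fin n → ℝ) (s : ℝ) : 0 ≤ meanExceed θ s :=
  Finset.sum_nonneg fun _ _ => exceedProb_nonneg _ _

lemma integral_exp_exceedInd (u a s : ℝ) :
    ∫ y, Real.exp (a * exceedInd s y) ∂(gaussianReal u 1) =
      1 + (Real.exp a - 1) * exceedProb u s := by
  have h : ∀ y, Real.exp (a * exceedInd s y) = 1 + (Real.exp a - 1) * exceedInd s y := by
    intro y
    by_cases hy : s ≤ |y| <;> simp [exceedInd, hy]
  have hi : Integrable (exceedInd s) (gaussianReal u 1) :=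
    (integrable_const 1).indicator (measurableSet_exceed s)
  simp_rw [h]
  rw [integral_add (integrable_const _) (hi.const_mul _), integral_const_mul]
  have : ∫ y, exceedInd s y ∂(gaussianReal u 1) = exceedProb u s := by
    unfold exceedInd exceedProb
    rw [integral_indicator_one (measurableSet_exceed s)]
  rw [this]; simp

lemma integral_exp_exceedInd_le (u a s : ℝ) :
    ∫ y, Real.exp (a * exceedInd s y) ∂(gaussianReal u 1) ≤
      Real.exp ((Real.exp a - 1) * exceedProb u s) := by
  rw [integral_exp_exceedInd, add_comm]
  exact Real.add_one_le_exp _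

lemma integral_exp_exceed_le {n : ℕ} (θ : Fin n → ℝ) (a s : ℝ) :
    ∫ x, Real.exp (a * exceed x s) ∂(obsLaw θ) ≤ Real.exp ((Real.exp a - 1) * meanExceed θ s) := by
  simp_rw [exceed_eq_sum, Finset.mul_sum, Real.exp_sum]
  rw [integral_fintype_prod_eq_prod (fun _ y => Real.exp (a * exceedInd s y)), meanExceed,
    Finset.mul_sum, Real.exp_sum]
  exact Finset.prod_le_prod (fun i _ => integral_nonneg fun y => Real.exp_nonneg _)
    fun i _ => integral_exp_exceedInd_le _ _ _

/-- By independence the integral factors. In coordinate i the exceedance indicator is at most 1, so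
decoupling f from the count costs only a factor e^a. -/
lemma integral_mul_exp_exceed_le {n : ℕ} (θ : Fin n → ℝ) {a : ℝ} (ha : 0 ≤ a) (s : ℝ) (i : Fin n)
    {f : ℝ → ℝ} (hf0 : ∀ y, 0 ≤ f y) (hf : Integrable f (gaussianReal (θ i) 1)) :
    ∫ x, f (x i) * Real.exp (a * exceed x s) ∂(obsLaw θ) ≤
      (∫ y, f y ∂(gaussianReal (θ i) 1)) * Real.exp (a + (Real.exp a - 1) * meanExceed θ s) := by
  classical
  have e : ∀ x : Fin n → ℝ, f (x i) * Real.exp (a * exceed x s) =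
      ∏ j, (if j = i then f (x j) else 1) * Real.exp (a * exceedInd s (x j)) := by
    intro x
    rw [Finset.prod_mul_distrib, exceed_eq_sum, Finset.mul_sum, Real.exp_sum]
    simp
  simp_rw [e]
  rw [integral_fintype_prod_eq_prod
    (fun j y => (if j = i then f y else 1) * Real.exp (a * exceedInd s y))]
  have ea : 0 ≤ Real.exp a - 1 := by linarith [Real.add_one_le_exp a]
  have hI := integral_nonneg (μ := gaussianReal (θ i) 1) (f := f) hf0
  have hle : ∀ j, ∫ y, (if j = i then f y else 1) * Real.exp (a * exceedInd s y)
      ∂(gaussianReal (θ j) 1) ≤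
      (if j = i then (∫ y, f y ∂(gaussianReal (θ i) 1)) * Real.exp a else 1) *
        Real.exp ((Real.exp a - 1) * exceedProb (θ j) s) := by
    intro j
    by_cases hj : j = i
    · subst hj
      simp only [if_true]
      have h1 : ∀ y, Real.exp (a * exceedInd s y) ≤ Real.exp a := fun y =>
        Real.exp_le_exp.2 (by nlinarith [exceedInd_le_one s y])
      calc _ ≤ ∫ y, f y * Real.exp a ∂(gaussianReal (θ j) 1) := by
            refine integral_mono_of_nonneg (ae_of_all _ fun y => ?_) (hf.mul_const _)
              (ae_of_all _ fun y => ?_)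
            · exact mul_nonneg (hf0 y) (Real.exp_nonneg _)
            · exact mul_le_mul_of_nonneg_left (h1 y) (hf0 y)
        _ = (∫ y, f y ∂(gaussianReal (θ j) 1)) * Real.exp a * 1 := by
            rw [integral_mul_const, mul_one]
        _ ≤ _ := by
            gcongr
            exact Real.one_le_exp (mul_nonneg ea (exceedProb_nonneg _ _))
    · simp only [hj, if_false, one_mul]
      exact integral_exp_exceedInd_le _ _ _
  refine (Finset.prod_le_prod (fun j _ => integral_nonneg fun y => ?_) fun j _ => hle j).trans
    (le_of_eq ?_)
  · refine mul_nonneg ?_ (Real.exp_nonneg _)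
    split_ifs
    exacts [hf0 y, zero_le_one]
  · rw [Finset.prod_mul_distrib, ← Real.exp_sum, ← Finset.mul_sum, Real.exp_add, ← mul_assoc,
      meanExceed]
    simp

lemma integrable_comp_eval {n : ℕ} (θ : Fin n → ℝ) (i : Fin n) {f : ℝ → ℝ}
    (hf : Integrable f (gaussianReal (θ i) 1)) : Integrable (fun x => f (x i)) (obsLaw θ) :=
  (measurePreserving_eval (fun i => gaussianReal (θ i) 1) i).integrable_comp_of_integrable hf

lemma integral_comp_eval {n : ℕ} (θ : Fin n → ℝ) (i : Fin n) {f : ℝ → ℝ}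
    (hf : Integrable f (gaussianReal (θ i) 1)) :
    ∫ x, f (x i) ∂(obsLaw θ) = ∫ y, f y ∂(gaussianReal (θ i) 1) := by
  have h := measurePreserving_eval (fun i => gaussianReal (θ i) 1) i
  rw [← h.map_eq, integral_map h.aemeasurable (by rw [h.map_eq]; exact hf.1)]

lemma integrable_exp_exceed {n : ℕ} (θ : Fin n → ℝ) (a s : ℝ) :
    Integrable (fun x => Real.exp (a * exceed x s)) (obsLaw θ) := by
  refine Integrable.of_bound (C := Real.exp (|a| * n)) ?_ (ae_of_all _ fun x => ?_)
  · exact (Real.measurable_exp.comp (measurable_const.mul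
      (measurable_from_nat.comp (measurable_exceed s)))).aestronglyMeasurable
  · rw [Real.norm_of_nonneg (Real.exp_nonneg _)]
    have h1 : (exceed x s : ℝ) ≤ n := by exact_mod_cast exceed_le x s
    refine Real.exp_le_exp.2 ((mul_le_mul_of_nonneg_right (le_abs_self a) (by positivity)).trans ?_)
    gcongr

/-- Chernoff bound for the lower tail of the number of exceedances. -/
lemma integral_exceed_le_indicator {n : ℕ} (θ : Fin n → ℝ) (s : ℝ) (k : ℕ) :
    ∫ x, {x | exceed x s ≤ k}.indicator (fun _ => (1 : ℝ)) x ∂(obsLaw θ) ≤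
      Real.exp (k - 5 / 8 * meanExceed θ s) := by
  have hint := integrable_exp_exceed θ (-1) s
  calc _ ≤ ∫ x, Real.exp k * Real.exp (-1 * exceed x s) ∂(obsLaw θ) := by
        refine integral_mono_of_nonneg
          (ae_of_all _ fun x => Set.indicator_nonneg (fun _ _ => zero_le_one) x)
          (hint.const_mul _) (ae_of_all _ fun x => ?_)
        simp only [Set.indicator_apply, Set.mem_ofPred_eq]
        split_ifs with h
        · rw [← Real.exp_add]
          have : (exceed x s : ℝ) ≤ k := by exact_mod_cast h
          exact Real.one_le_exp (by linarith)
        · positivity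
    _ ≤ Real.exp k * Real.exp ((Real.exp (-1) - 1) * meanExceed θ s) := by
        rw [integral_const_mul]
        gcongr
        exact integral_exp_exceed_le θ (-1) s
    _ ≤ _ := by
        rw [← Real.exp_add]
        -- This is where 5/8 comes from: it bounds 1 - e⁻¹ from below.
        have h1 : Real.exp (-1) ≤ 3 / 8 := by
          have := Real.exp_neg_one_lt_d9
          linarith
        have := meanExceed_nonneg θ s
        exact Real.exp_le_exp.2 (by nlinarith)

/-! ### Risk of soft thresholding at mean zero. -/

lemma measurable_soft (lam : ℝ) : Measurable (soft lam) := by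
  unfold soft
  refine Measurable.mul ?_ (by fun_prop)
  unfold Real.sign
  exact Measurable.ite measurableSet_Iio measurable_const
    (Measurable.ite measurableSet_Ioi measurable_const measurable_const)

lemma abs_soft {lam : ℝ} (hl : 0 ≤ lam) (x : ℝ) : |soft lam x| = max (|x| - lam) 0 := by
  rw [soft, abs_mul, abs_of_nonneg (le_max_right (|x| - lam) 0)]
  rcases lt_trichotomy x 0 with h | h | h
  · simp [Real.sign_of_neg h]
  · simp [h, hl]
  · simp [Real.sign_of_pos h]

lemma soft_sq_eq {lam : ℝ} (hl : 0 ≤ lam) (x : ℝ) : soft lam x ^ 2 = (max (|x| - lam) 0) ^ 2 := by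
  rw [← sq_abs, abs_soft hl]

lemma soft_sq_anti {lam mu : ℝ} (hl : 0 ≤ lam) (h : lam ≤ mu) (x : ℝ) :
    soft mu x ^ 2 ≤ soft lam x ^ 2 := by
  rw [soft_sq_eq hl, soft_sq_eq (hl.trans h)]
  gcongr

lemma soft_sq_le {lam : ℝ} (hl : 0 ≤ lam) (x : ℝ) : soft lam x ^ 2 ≤ x ^ 2 := by
  rw [soft_sq_eq hl, ← sq_abs x]
  gcongr
  exact max_le (by linarith) (abs_nonneg x)

lemma integrable_sub_sq (u : ℝ) : Integrable (fun y => (y - u) ^ 2) (gaussianReal u 1) := by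
  have h : MemLp (fun y : ℝ => y - u) 2 (gaussianReal u 1) :=
    (memLp_id_gaussianReal' 2 (by simp)).sub (memLp_const u)
  exact h.integrable_sq

lemma integral_sub_sq (u : ℝ) : ∫ y, (y - u) ^ 2 ∂(gaussianReal u 1) = 1 := by
  have h := variance_fun_id_gaussianReal (μ := u) (v := 1)
  rw [variance_eq_integral (by fun_prop)] at h
  simpa using h

lemma integrable_soft_sub_sq {lam : ℝ} (hl : 0 ≤ lam) (u : ℝ) :
    Integrable (fun y => soft lam (y - u) ^ 2) (gaussianReal u 1) :=
  (integrable_sub_sq u).mono'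
    (((measurable_soft lam).comp (measurable_id.sub_const u)).pow_const 2).aestronglyMeasurable
    (ae_of_all _ fun y => by
      rw [Real.norm_of_nonneg (sq_nonneg _)]; exact soft_sq_le hl _)

lemma integral_soft_sub_sq (lam u : ℝ) :
    ∫ y, soft lam (y - u) ^ 2 ∂(gaussianReal u 1) = softRisk 0 lam := by
  have h := gaussianReal_map_add_const (μ := 0) (v := 1) u
  rw [zero_add] at h
  have hm : Measurable fun y => soft lam (y - u) ^ 2 :=
    ((measurable_soft lam).comp (measurable_id.sub_const u)).pow_const 2
  rw [← h, integral_map (by fun_prop) hm.aestronglyMeasurable]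
  simp [softRisk]

lemma softRisk_zero_nonneg (lam : ℝ) : 0 ≤ softRisk 0 lam :=
  integral_nonneg fun _ => sq_nonneg _

lemma softRisk_zero_anti {lam mu : ℝ} (hl : 0 ≤ lam) (h : lam ≤ mu) :
    softRisk 0 mu ≤ softRisk 0 lam := by
  rw [← integral_soft_sub_sq mu 0, ← integral_soft_sub_sq lam 0]
  exact integral_mono (integrable_soft_sub_sq (hl.trans h) 0) (integrable_soft_sub_sq hl 0)
    fun y => soft_sq_anti hl h _

/-- Contribution of one coordinate on the event of at least `k` exceedances. -/
lemma integral_soft_indicator_exceed_le {n : ℕ} (θ : Fin n → ℝ) {a : ℝ} (ha : 0 ≤ a) (s : ℝ)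
    (i : Fin n) (k : ℕ) {lam : ℝ} (hl : 0 ≤ lam) :
    ∫ x, {x | k ≤ exceed x s}.indicator (fun x => soft lam (x i - θ i) ^ 2) x ∂(obsLaw θ) ≤
      softRisk 0 lam * Real.exp (a - a * k + (Real.exp a - 1) * meanExceed θ s) := by
  have hf := integrable_soft_sub_sq hl (θ i)
  have hint : Integrable (fun x => soft lam (x i - θ i) ^ 2 * Real.exp (a * exceed x s))
      (obsLaw θ) := by
    refine (integrable_comp_eval θ i hf).mul_bdd (c := Real.exp (a * n))
      (integrable_exp_exceed θ a s).1 (ae_of_all _ fun x => ?_)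
    rw [Real.norm_of_nonneg (Real.exp_nonneg _)]
    have h1 : (exceed x s : ℝ) ≤ n := by exact_mod_cast exceed_le x s
    exact Real.exp_le_exp.2 (by gcongr)
  calc _ ≤ ∫ x, Real.exp (-(a * k)) * (soft lam (x i - θ i) ^ 2 * Real.exp (a * exceed x s))
        ∂(obsLaw θ) := by
        refine integral_mono_of_nonneg
          (ae_of_all _ fun x => Set.indicator_nonneg (fun _ _ => sq_nonneg _) x)
          (hint.const_mul _) (ae_of_all _ fun x => ?_)
        simp only [Set.indicator_apply, Set.mem_ofPred_eq]
        split_ifs with h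
        · rw [mul_left_comm, ← Real.exp_add]
          have : (k : ℝ) ≤ exceed x s := by exact_mod_cast h
          refine le_mul_of_one_le_right (sq_nonneg _) (Real.one_le_exp ?_)
          nlinarith
        · positivity
    _ ≤ Real.exp (-(a * k)) * (softRisk 0 lam *
          Real.exp (a + (Real.exp a - 1) * meanExceed θ s)) := by
        rw [integral_const_mul, ← integral_soft_sub_sq lam (θ i)]
        gcongr
        exact integral_mul_exp_exceed_le θ ha s i (f := fun y => soft lam (y - θ i) ^ 2)
          (fun y => sq_nonneg _) hf
    _ = _ := by
        rw [mul_left_comm, ← Real.exp_add]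
        ring_nf

lemma softRisk_zero_eq_integral {lam : ℝ} (hl : 0 ≤ lam) :
    softRisk 0 lam = 2 * ∫ x in Set.Ioi 0, φ x * (max (x - lam) 0) ^ 2 := by
  rw [softRisk, integral_gaussianReal_eq_integral_smul one_ne_zero,
    ← integral_comp_abs (f := fun x => φ x * (max (x - lam) 0) ^ 2)]
  congr 1; ext x
  rw [add_zero, sub_zero, soft_sq_eq hl, smul_eq_mul, stdPDF_eq, stdPDF_eq, sq_abs]

lemma integrable_stdPDF_mul_softSq {lam : ℝ} (hl : 0 ≤ lam) :
    IntegrableOn (fun x => φ x * (max (x - lam) 0) ^ 2) (Set.Ioi 0) := by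
  have h := integrable_soft_sub_sq hl 0
  rw [gaussianReal_of_var_ne_zero 0 one_ne_zero,
    integrable_withDensity_iff_integrable_smul' (measurable_gaussianPDF 0 1)
      (ae_of_all _ fun _ => gaussianPDF_lt_top)] at h
  refine h.integrableOn.congr_fun (fun x hx => ?_) measurableSet_Ioi
  simp only [toReal_gaussianPDF, smul_eq_mul, sub_zero]
  rw [soft_sq_eq hl, abs_of_pos hx]

/-- On the window (lam+d, lam+2d] with d = 1/(1+lam), the soft threshold is at least d and x²/2
exceeds lam²/2 by at most 4. With `softRisk_zero_upper` this fixes the exact order, which is needed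
since the risk is later raised to the power 1+δ. -/
lemma softRisk_zero_lower : ∃ c : ℝ, 0 < c ∧ c ≤ 1 ∧ ∀ lam : ℝ, 0 ≤ lam →
    c * Real.exp (-(lam ^ 2 / 2)) / (1 + lam) ^ 3 ≤ softRisk 0 lam := by
  set p : ℝ := (√(2 * Real.pi))⁻¹
  have hp : 0 < p := by positivity
  have hp1 : p ≤ 1 := inv_le_one_of_one_le₀ (by
    rw [Real.one_le_sqrt]; linarith [Real.pi_gt_three])
  refine ⟨p * Real.exp (-4), by positivity, ?_, fun lam hl => ?_⟩
  · exact mul_le_one₀ hp1 (Real.exp_nonneg _) (Real.exp_le_one_iff.2 (by norm_num))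
  set d : ℝ := 1 / (1 + lam) with hd
  have hd0 : 0 < d := by positivity
  have hdl : d * (1 + lam) = 1 := by rw [hd]; field_simp
  have hd1 : d ≤ 1 := by nlinarith
  have h1 : ∀ x ∈ Set.Ioc (lam + d) (lam + d + d),
      p * Real.exp (-4) * Real.exp (-(lam ^ 2 / 2)) * d ^ 2 ≤ φ x * (max (x - lam) 0) ^ 2 := by
    intro x hx
    rw [stdPDF_eq, mul_assoc p, ← Real.exp_add]
    have h2 : d ≤ max (x - lam) 0 := le_max_of_le_left (by linarith [hx.1])
    have h3 : x ^ 2 ≤ (lam + d + d) ^ 2 := by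
      have : 0 ≤ x := by linarith [hx.1]
      gcongr
      exact hx.2
    gcongr
    nlinarith
  rw [softRisk_zero_eq_integral hl]
  have e : p * Real.exp (-4) * Real.exp (-(lam ^ 2 / 2)) / (1 + lam) ^ 3 =
      ∫ x in Set.Ioc (lam + d) (lam + d + d),
        p * Real.exp (-4) * Real.exp (-(lam ^ 2 / 2)) * d ^ 2 := by
    rw [setIntegral_const]
    simp only [Real.volume_real_Ioc, smul_eq_mul, add_sub_cancel_left, max_eq_left hd0.le]
    rw [hd]; field_simp
  rw [e]
  have hI := integrable_stdPDF_mul_softSq hl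
  have hnn : ∀ x, 0 ≤ φ x * (max (x - lam) 0) ^ 2 := fun x =>
    mul_nonneg (stdPDF_nonneg x) (sq_nonneg _)
  have hsub : Set.Ioc (lam + d) (lam + d + d) ⊆ Set.Ioi 0 := fun x hx => by
    have := hx.1
    simp only [Set.mem_Ioi]; linarith
  calc _ ≤ ∫ x in Set.Ioc (lam + d) (lam + d + d), φ x * (max (x - lam) 0) ^ 2 :=
        setIntegral_mono_on (integrableOn_const (by simp)) (hI.mono_set hsub) measurableSet_Ioc h1
    _ ≤ ∫ x in Set.Ioi 0, φ x * (max (x - lam) 0) ^ 2 :=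
        setIntegral_mono_set hI (ae_of_all _ hnn) (Filter.Eventually.of_forall hsub)
    _ ≤ _ := by
        have : 0 ≤ ∫ x in Set.Ioi 0, φ x * (max (x - lam) 0) ^ 2 := integral_nonneg hnn
        linarith

lemma softRisk_zero_upper : ∃ C : ℝ, 0 < C ∧ ∀ lam : ℝ, 0 ≤ lam →
    softRisk 0 lam ≤ C * Real.exp (-(lam ^ 2 / 2)) / (1 + lam) ^ 3 := by
  set p : ℝ := (√(2 * Real.pi))⁻¹
  have hp : 0 < p := by positivity
  refine ⟨2 * (p * Real.exp (1 / 2) * 8 * 2), by positivity, fun lam hl => ?_⟩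
  rw [softRisk_zero_eq_integral hl]
  -- With x = lam + t, t²/2 ≥ t - 1/2 gives the decay e^{-(1+lam)t} = e^{-2bt}. One factor e^{-bt}
  -- absorbs t², the other is integrated.
  set b : ℝ := (1 + lam) / 2 with hb
  have hb0 : 0 < b := by positivity
  set K : ℝ := p * Real.exp (1 / 2) * 8 * Real.exp (-(lam ^ 2 / 2)) / (1 + lam) ^ 2
  have hK : 0 ≤ K := by positivity
  have hle : ∀ x ∈ Set.Ioi lam, φ x * (max (x - lam) 0) ^ 2 ≤
      K * Real.exp (b * lam) * Real.exp (-b * x) := by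
    intro x hx
    have ht : 0 ≤ x - lam := sub_nonneg.2 (le_of_lt hx)
    rw [max_eq_left ht]
    set t := x - lam with htd
    have hx' : x = lam + t := by ring
    have e1 : φ x ≤ p * (Real.exp (1 / 2) * Real.exp (-(lam ^ 2 / 2)) * Real.exp (-(2 * b * t))) := by
      rw [stdPDF_eq, ← Real.exp_add, ← Real.exp_add]
      gcongr
      rw [hx', hb]
      nlinarith [sq_nonneg (t - 1)]
    have e2 : t ^ 2 ≤ 8 / (1 + lam) ^ 2 * Real.exp (b * t) := by
      have := Real.quadratic_le_exp_of_nonneg (mul_nonneg hb0.le ht)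
      have h4 : (b * t) ^ 2 ≤ 2 * Real.exp (b * t) := by nlinarith [mul_nonneg hb0.le ht]
      rw [div_mul_eq_mul_div, le_div_iff₀ (by positivity)]
      have : t ^ 2 * (1 + lam) ^ 2 = 4 * (b * t) ^ 2 := by rw [hb]; ring
      linarith
    calc φ x * t ^ 2 ≤ _ := mul_le_mul e1 e2 (sq_nonneg t) (by positivity)
      _ = K * (Real.exp (-(2 * b * t)) * Real.exp (b * t)) := by simp only [K]; ring
      _ = _ := by
        rw [mul_assoc K, ← Real.exp_add, ← Real.exp_add, hx']
        congr 2; ring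
  have hexp : IntegrableOn (fun x => K * Real.exp (b * lam) * Real.exp (-b * x)) (Set.Ioi lam) :=
    (integrableOn_exp_mul_Ioi (by linarith) lam).const_mul _
  have hI := integrable_stdPDF_mul_softSq hl
  have hU : Set.Ioc 0 lam ∪ Set.Ioi lam = Set.Ioi 0 := Set.Ioc_union_Ioi_eq_Ioi hl
  have hsub1 : Set.Ioc 0 lam ⊆ Set.Ioi 0 := fun x hx => hx.1
  have hsub2 : Set.Ioi lam ⊆ Set.Ioi 0 := Set.Ioi_subset_Ioi hl
  have hz : ∫ x in Set.Ioc 0 lam, φ x * (max (x - lam) 0) ^ 2 = 0 := by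
    rw [setIntegral_congr_fun measurableSet_Ioc (g := fun _ => 0)]
    · simp
    · intro x hx
      simp [max_eq_right (sub_nonpos.2 hx.2)]
  rw [← hU, setIntegral_union (Set.Ioc_disjoint_Ioi le_rfl) measurableSet_Ioi (hI.mono_set hsub1)
    (hI.mono_set hsub2), hz, zero_add]
  have := setIntegral_mono_on (hI.mono_set hsub2) hexp measurableSet_Ioi hle
  rw [integral_const_mul, integral_exp_mul_Ioi (by linarith)] at this
  have e3 : K * Real.exp (b * lam) * (-Real.exp (-b * lam) / -b) = K * (2 / (1 + lam)) := by
    rw [neg_div_neg_eq, neg_mul, Real.exp_neg, hb]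
    field_simp
  rw [e3] at this
  calc _ ≤ 2 * (K * (2 / (1 + lam))) := by linarith
    _ = _ := by simp only [K]; field_simp

/-- The risk has order e^{-lam²/2}/(1+lam)³. Scaling the level by √(1+δ) and taking the power 1+δ
have the same effect on the exponential; the polynomial factors differ by (1+lam)^{3δ}. -/
lemma softRisk_zero_sqrt_mul_le (A : ℝ) : ∃ C : ℝ, 0 < C ∧ ∀ lam δ : ℝ, 0 ≤ lam → 0 ≤ δ → δ ≤ A →
    softRisk 0 (√(1 + δ) * lam) ≤ C * softRisk 0 lam ^ (1 + δ) * (1 + lam) ^ (3 * δ) := by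
  obtain ⟨c, hc, hc1, hlow⟩ := softRisk_zero_lower
  obtain ⟨D, hD, hup⟩ := softRisk_zero_upper
  refine ⟨D / c ^ (1 + A), by positivity, fun lam δ hl hδ hA => ?_⟩
  have hl1 : 0 < 1 + lam := by linarith
  have h1 := hup (√(1 + δ) * lam) (by positivity)
  have hs : 1 ≤ √(1 + δ) := Real.one_le_sqrt.2 (by linarith)
  rw [mul_pow, Real.sq_sqrt (by linarith)] at h1
  have h2 : D * Real.exp (-((1 + δ) * lam ^ 2 / 2)) / (1 + √(1 + δ) * lam) ^ 3 ≤
      D * Real.exp (-((1 + δ) * lam ^ 2 / 2)) / (1 + lam) ^ 3 := by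
    gcongr
    nlinarith
  have h3 : (c * Real.exp (-(lam ^ 2 / 2)) / (1 + lam) ^ 3) ^ (1 + δ) ≤ softRisk 0 lam ^ (1 + δ) :=
    Real.rpow_le_rpow (by positivity) (hlow lam hl) (by linarith)
  have h4 : (c * Real.exp (-(lam ^ 2 / 2)) / (1 + lam) ^ 3) ^ (1 + δ) * (1 + lam) ^ (3 * δ) =
      c ^ (1 + δ) * Real.exp (-((1 + δ) * lam ^ 2 / 2)) / (1 + lam) ^ 3 := by
    rw [Real.div_rpow (by positivity) (by positivity), Real.mul_rpow hc.le (Real.exp_nonneg _),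
      ← Real.exp_mul, ← Real.rpow_natCast (1 + lam) 3, ← Real.rpow_mul hl1.le,
      show ((3 : ℕ) : ℝ) * (1 + δ) = (3 : ℕ) + 3 * δ by push_cast; ring, Real.rpow_add hl1]
    rw [show -(lam ^ 2 / 2) * (1 + δ) = -((1 + δ) * lam ^ 2 / 2) by ring]
    have : (1 + lam) ^ (3 * δ) ≠ 0 := (Real.rpow_pos_of_pos hl1 _).ne'
    field_simp
  have h5 : c ^ (1 + A) ≤ c ^ (1 + δ) := Real.rpow_le_rpow_of_exponent_ge hc hc1 (by linarith)
  calc _ ≤ D * Real.exp (-((1 + δ) * lam ^ 2 / 2)) / (1 + lam) ^ 3 := h1.trans h2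
    _ = D / c ^ (1 + A) * (c ^ (1 + A) * Real.exp (-((1 + δ) * lam ^ 2 / 2)) / (1 + lam) ^ 3) := by
        field_simp
    _ ≤ D / c ^ (1 + A) * (c ^ (1 + δ) * Real.exp (-((1 + δ) * lam ^ 2 / 2)) / (1 + lam) ^ 3) := by
        gcongr
    _ ≤ D / c ^ (1 + A) * (softRisk 0 lam ^ (1 + δ) * (1 + lam) ^ (3 * δ)) := by
        rw [← h4]; gcongr
    _ = _ := by ring

/-! ### Growth of the noise risk along the candidate levels. -/

lemma rpow_le_of_comparable {x y s r m : ℝ} (hx : 0 < x) (hy : 0 < y) (hs : 1 ≤ s)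
    (hxy : x ≤ s * y) (hyx : y ≤ s * x) (hr : |r| ≤ m) : x ^ r ≤ s ^ m * y ^ r := by
  have hs0 : 0 < s := by linarith
  have h1 : s ^ |r| ≤ s ^ m := Real.rpow_le_rpow_of_exponent_le hs hr
  refine le_trans ?_ (mul_le_mul_of_nonneg_right h1 (Real.rpow_nonneg hy.le r))
  rcases le_total 0 r with h | h
  · rw [abs_of_nonneg h, ← Real.mul_rpow hs0.le hy.le]
    exact Real.rpow_le_rpow hx.le hxy h
  · rw [abs_of_nonpos h, Real.rpow_neg hs0.le, ← Real.inv_rpow hs0.le,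
      ← Real.mul_rpow (by positivity) hy.le]
    refine Real.rpow_le_rpow_of_nonpos (by positivity) ?_ h
    rw [inv_mul_le_iff₀ hs0]
    exact hyx

/-- The weight `(log L)^(-c₂) / L^(c₁/2)`. -/
def weight (c1 c2 L : ℝ) : ℝ := Real.log L ^ (-c2) / L ^ (c1 / 2)

lemma one_le_log_of_exp_le {L : ℝ} (hL : Real.exp 1 ≤ L) : 1 ≤ Real.log L := by
  rwa [Real.le_log_iff_exp_le ((Real.exp_pos 1).trans_le hL)]

lemma pos_of_exp_le {L : ℝ} (hL : Real.exp 1 ≤ L) : 0 < L := (Real.exp_pos 1).trans_le hL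

lemma one_le_of_exp_le {L : ℝ} (hL : Real.exp 1 ≤ L) : 1 ≤ L :=
  (Real.one_le_exp zero_le_one).trans hL

lemma weight_pos {c1 c2 L : ℝ} (hL : Real.exp 1 ≤ L) : 0 < weight c1 c2 L :=
  div_pos (Real.rpow_pos_of_pos (by linarith [one_le_log_of_exp_le hL]) _)
    (Real.rpow_pos_of_pos (pos_of_exp_le hL) _)

lemma log_le_mul_log {x y s : ℝ} (hx : 0 < x) (hy : Real.exp 1 ≤ y) (hs : 1 ≤ s)
    (h : x ≤ s * y) : Real.log x ≤ s * Real.log y := by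
  have hy0 := pos_of_exp_le hy
  have h1 := Real.log_le_log hx h
  rw [Real.log_mul (by linarith) hy0.ne'] at h1
  have h2 := Real.log_le_sub_one_of_pos (by linarith : 0 < s)
  have h3 := one_le_log_of_exp_le hy
  nlinarith

/-- Since both arguments are at least e, comparability passes to their logarithms. The bounds on c₁
and c₂ make the constant uniform in them, whatever the sign of c₂. -/
lemma weight_le_of_comparable {c1 c2 M0 s l L : ℝ} (hc1 : 0 < c1) (hc1' : c1 ≤ 2)
    (hc2 : |c2| ≤ M0) (hs : 1 ≤ s) (hl : Real.exp 1 ≤ l) (hL : Real.exp 1 ≤ L)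
    (h1 : l ≤ s * L) (h2 : L ≤ s * l) : weight c1 c2 l ≤ s ^ (M0 + 1) * weight c1 c2 L := by
  have hl0 := pos_of_exp_le hl
  have hL0 := pos_of_exp_le hL
  have a1 := rpow_le_of_comparable (r := -c2) (m := M0) (by linarith [one_le_log_of_exp_le hl])
    (by linarith [one_le_log_of_exp_le hL]) hs (log_le_mul_log hl0 hL hs h1)
    (log_le_mul_log hL0 hl hs h2) (by rwa [abs_neg])
  have a2 := rpow_le_of_comparable (r := -(c1 / 2)) (m := 1) hl0 hL0 hs h1 h2
    (by rw [abs_neg, abs_of_pos (by linarith)]; linarith)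
  rw [Real.rpow_neg hl0.le, Real.rpow_neg hL0.le] at a2
  rw [weight, weight, div_eq_mul_inv, div_eq_mul_inv, Real.rpow_add (by linarith)]
  calc _ ≤ (s ^ M0 * Real.log L ^ (-c2)) * (s ^ (1 : ℝ) * (L ^ (c1 / 2))⁻¹) :=
        mul_le_mul a1 a2 (by positivity) (mul_nonneg (by positivity)
          (Real.rpow_nonneg (by linarith [one_le_log_of_exp_le hL]) _))
    _ = _ := by rw [Real.rpow_one]; ring_nf

/-- Recasts the risk hypothesis in terms of x², the quantity comparable with log(1/y). The factor
2^M0 pays for log(e ∨ x²) against 1 ∨ log x, the factor e for (e ∨ x²)^{c₁/2} against x^{c₁} + 2. -/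
lemma softRisk_zero_level_le {M0 c1 c2 : ℝ} {g : ℝ → ℝ} (hg : LevelCondition M0 c1 c2 g) {x : ℝ}
    (hx : 0 < x) : softRisk 0 (g x) ≤
      M0 * (2 ^ M0 * Real.exp 1) * Phi (-x) * weight c1 c2 (max (Real.exp 1) (x ^ 2)) := by
  set l := max (Real.exp 1) (x ^ 2)
  have hM0 : 0 ≤ M0 := (abs_nonneg c2).trans hg.abs_c2_le
  have hl : Real.exp 1 ≤ l := le_max_left _ _
  have hl0 := pos_of_exp_le hl
  have he := Real.exp_pos 1
  have hlog : Real.log l = max 1 (2 * Real.log x) := by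
    have : Real.log (x ^ 2) = 2 * Real.log x := by rw [Real.log_pow]; norm_num
    rw [← this]
    rcases le_total (Real.exp 1) (x ^ 2) with h | h
    · rw [show l = x ^ 2 from max_eq_right h, max_eq_right (one_le_log_of_exp_le h)]
    · rw [show l = Real.exp 1 from max_eq_left h, Real.log_exp, max_eq_left]
      rw [Real.log_le_iff_le_exp (by positivity)]; exact h
  set m := max 1 (Real.log x)
  have hm1 : 1 ≤ m := le_max_left _ _
  have hlx : Real.log x ≤ m := le_max_right _ _
  have hL1 := one_le_log_of_exp_le hl
  have b1 : m ≤ 2 * Real.log l := by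
    refine max_le (by linarith) ?_
    have : 2 * Real.log x ≤ Real.log l := hlog ▸ le_max_right _ _
    linarith
  have b2 : Real.log l ≤ 2 * m := by
    rw [hlog]; exact max_le (by linarith) (by linarith)
  have a1 := rpow_le_of_comparable (r := -c2) (m := M0) (by linarith) (by linarith)
    one_le_two b1 b2 (by rw [abs_neg]; exact hg.abs_c2_le)
  have a2 : l ^ (c1 / 2) ≤ Real.exp 1 * (x ^ c1 + 2) := by
    have hxc := Real.rpow_nonneg hx.le c1
    have e1 : 1 ≤ Real.exp 1 := Real.one_le_exp zero_le_one
    rcases le_total (Real.exp 1) (x ^ 2) with h | h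
    · rw [show l = x ^ 2 from max_eq_right h, ← Real.rpow_natCast x 2, ← Real.rpow_mul hx.le]
      rw [show ((2 : ℕ) : ℝ) * (c1 / 2) = c1 by push_cast; ring]
      nlinarith
    · rw [show l = Real.exp 1 from max_eq_left h]
      have : Real.exp 1 ^ (c1 / 2) ≤ Real.exp 1 ^ (1 : ℝ) :=
        Real.rpow_le_rpow_of_exponent_le e1 (by linarith [hg.c1_le])
      rw [Real.rpow_one] at this
      nlinarith
  have hxc : 0 < x ^ c1 + 2 := by have := Real.rpow_nonneg hx.le c1; linarith
  have hP := Phi_nonneg (-x)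
  refine (hg.risk_le x hx).trans ((min_le_right _ _).trans ?_)
  rw [show M0 * Phi (-x) / ((x ^ c1 + 2) * m ^ c2) =
    M0 * Phi (-x) * (m ^ (-c2) * (1 / (x ^ c1 + 2))) by
      rw [Real.rpow_neg (by linarith)]; field_simp]
  have a3 : 1 / (x ^ c1 + 2) ≤ Real.exp 1 / l ^ (c1 / 2) := by
    rw [div_le_div_iff₀ hxc (by positivity)]; linarith
  calc _ ≤ M0 * Phi (-x) * ((2 ^ M0 * Real.log l ^ (-c2)) * (Real.exp 1 / l ^ (c1 / 2))) := by
        refine mul_le_mul_of_nonneg_left ?_ (by positivity)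
        exact mul_le_mul a1 a3 (by positivity) (mul_nonneg (by positivity)
          (Real.rpow_nonneg (by linarith) _))
    _ = _ := by rw [weight]; ring

/-- `ξ_k²` is of the order `log (1/y)` when `k ≥ n y`, up to the factor `k / (n y)`. -/
lemma xi_sq_comparable (α2' : ℝ) (h0 : 0 < α2') : ∃ C : ℝ, 1 ≤ C ∧
    ∀ (α : ℝ) (n k : ℕ) (y : ℝ), α2' < α → α < 1 → 1 ≤ k → k ≤ n → 0 < y → y ≤ 1 → n * y ≤ k →
      max (Real.exp 1) (xi α n k ^ 2) ≤ C * max (Real.exp 1) (Real.log (1 / y)) ∧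
      max (Real.exp 1) (Real.log (1 / y)) ≤
        C * (k / (n * y)) * max (Real.exp 1) (xi α n k ^ 2) := by
  set c : ℝ := (√(2 * Real.pi))⁻¹ * Real.exp (-1)
  have hc : 0 < c := by positivity
  refine ⟨3 + 2 * |Real.log (1 / α2')| + |Real.log (1 / (2 * c))|, by
    have := abs_nonneg (Real.log (1 / α2')); have := abs_nonneg (Real.log (1 / (2 * c))); linarith,
    fun α n k y hα hα1 hk hkn hy hy1 hnk => ?_⟩
  have hk0 : (1 : ℝ) ≤ k := by exact_mod_cast hk
  have hkn' : (k : ℝ) ≤ n := by exact_mod_cast hkn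
  have hn0 : (0 : ℝ) < n := by linarith
  have hα0 : 0 < α := h0.trans hα
  set x := xi α n k
  have hx : 0 < x := xi_pos hα0 hα1 hk hkn
  have hP : Phi (-x) = α * k / (2 * n) := Phi_neg_xi hα0 hα1 hk (by omega)
  set L := max (Real.exp 1) (Real.log (1 / y))
  set l := max (Real.exp 1) (x ^ 2)
  have hL : Real.exp 1 ≤ L := le_max_left _ _
  have hl : Real.exp 1 ≤ l := le_max_left _ _
  have hL1 := one_le_of_exp_le hL
  have hl1 := one_le_of_exp_le hl
  have hLy : Real.log (1 / y) ≤ L := le_max_right _ _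
  have hlx : x ^ 2 ≤ l := le_max_right _ _
  have A1 := abs_nonneg (Real.log (1 / α2'))
  have A2 := abs_nonneg (Real.log (1 / (2 * c)))
  have A3 := le_abs_self (Real.log (1 / α2'))
  have A4 := le_abs_self (Real.log (1 / (2 * c)))
  have hq : 1 ≤ k / (n * y) := by rw [one_le_div (by positivity)]; exact hnk
  constructor
  · refine max_le (by nlinarith) ?_
    -- The chain is α₂' y ≤ 2Φ(-x) ≤ e^{-x²/2}; take logarithms.
    have h1 := Phi_neg_upper x hx.le
    rw [hP] at h1
    have h2 : α2' * y ≤ Real.exp (-(x ^ 2 / 2)) := by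
      have : α2' * y ≤ 2 * (α * k / (2 * n)) := by
        rw [show 2 * (α * k / (2 * n)) = α * (k / n) by field_simp]
        have : y ≤ k / n := by rw [le_div_iff₀ hn0]; linarith
        gcongr
      linarith
    have h3 := Real.log_le_log (by positivity) h2
    rw [Real.log_exp, Real.log_mul h0.ne' hy.ne'] at h3
    have h4 : Real.log (1 / α2') = -Real.log α2' := by rw [one_div, Real.log_inv]
    rw [one_div, Real.log_inv] at hLy
    have h5 := mul_le_mul_of_nonneg_left hL1 A1
    have h6 := mul_nonneg A2 (by linarith : 0 ≤ L)
    linarith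
  · refine max_le (hl.trans (le_mul_of_one_le_left (by linarith) (by nlinarith))) ?_
    -- Conversely c e^{-x²} ≤ k/(2n) = (k/(ny)) y/2. The logarithm of k/(ny) is bounded by k/(ny)
    -- itself, hence the linear factor in the statement.
    have h1 := Phi_neg_lower x hx.le
    rw [hP] at h1
    have h2 : c * Real.exp (-x ^ 2) ≤ k / (2 * n) := by
      refine h1.trans ?_
      gcongr
      nlinarith
    have h3 := Real.log_le_log (by positivity) h2
    rw [Real.log_mul hc.ne' (Real.exp_pos _).ne', Real.log_exp] at h3
    have h4 : Real.log (k / (2 * n)) = Real.log (k / (n * y)) + Real.log y - Real.log 2 := by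
      rw [← Real.log_mul (by positivity) hy.ne', ← Real.log_div (by positivity) (by norm_num)]
      congr 1; field_simp
    have h5 := Real.log_le_sub_one_of_pos (by linarith : (0 : ℝ) < k / (n * y))
    have h6 : Real.log (1 / (2 * c)) = -Real.log 2 - Real.log c := by
      rw [one_div, Real.log_inv, Real.log_mul (by norm_num) hc.ne']; ring
    have h7 : Real.log (1 / y) ≤ l + |Real.log (1 / (2 * c))| + k / (n * y) := by
      rw [one_div, Real.log_inv]; linarith
    have hlq : 1 ≤ k / (n * y) * l := by nlinarith
    have g1 := mul_nonneg A1 (by linarith : 0 ≤ k / (n * y) * l)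
    have g2 := mul_le_mul_of_nonneg_left hlq A2
    have g3 : l ≤ k / (n * y) * l := le_mul_of_one_le_left (by linarith) hq
    have g4 : k / (n * y) ≤ k / (n * y) * l := le_mul_of_one_le_right (by linarith) hl1
    linarith

/-- With q = k/(ny), the tail Φ(-ξ_k) ≤ yq gives one power of q, and changing the argument of the
weight from ξ_k² to log(1/y) gives M0 + 1 more. Polynomial growth is all the Chernoff bound can
absorb. -/
lemma softRisk_level_xi_le (α2' M0 : ℝ) (h0 : 0 < α2') : ∃ D : ℝ, 0 < D ∧
    ∀ (c1 c2 : ℝ) (g : ℝ → ℝ), LevelCondition M0 c1 c2 g →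
    ∀ (α : ℝ) (n k : ℕ) (y : ℝ), α2' < α → α < 1 → 1 ≤ k → k ≤ n → 0 < y → y ≤ 1 → n * y ≤ k →
      softRisk 0 (g (xi α n k)) ≤
        D * y * (k / (n * y)) ^ (M0 + 2) * weight c1 c2 (max (Real.exp 1) (Real.log (1 / y))) := by
  obtain ⟨C, hC, hcomp⟩ := xi_sq_comparable α2' h0
  refine ⟨max 1 (M0 * (2 ^ M0 * Real.exp 1) * C ^ (M0 + 1)), by positivity,
    fun c1 c2 g hg α n k y hα hα1 hk hkn hy hy1 hnk => ?_⟩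
  have hM0 : 0 ≤ M0 := (abs_nonneg c2).trans hg.abs_c2_le
  have hα0 : 0 < α := h0.trans hα
  have hx : 0 < xi α n k := xi_pos hα0 hα1 hk hkn
  have hP : Phi (-xi α n k) = α * k / (2 * n) := Phi_neg_xi hα0 hα1 hk (by omega)
  obtain ⟨h1, h2⟩ := hcomp α n k y hα hα1 hk hkn hy hy1 hnk
  have hk0 : (1 : ℝ) ≤ k := by exact_mod_cast hk
  have hkn' : (k : ℝ) ≤ n := by exact_mod_cast hkn
  have hn0 : (0 : ℝ) < n := by linarith
  set q : ℝ := k / (n * y)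
  have hq : 1 ≤ q := by rw [one_le_div (by positivity)]; exact hnk
  have hL : Real.exp 1 ≤ max (Real.exp 1) (Real.log (1 / y)) := le_max_left _ _
  have hW := weight_le_of_comparable (M0 := M0) (s := C * q) hg.c1_pos hg.c1_le hg.abs_c2_le
    (by nlinarith) (le_max_left _ _) hL
    (h1.trans (by have := pos_of_exp_le hL; gcongr; nlinarith)) h2
  have hw := weight_pos (c1 := c1) (c2 := c2) hL
  have hP' : Phi (-xi α n k) ≤ y * q := by
    rw [hP, show y * q = k / n by simp only [q]; field_simp, div_le_div_iff₀ (by positivity) hn0]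
    nlinarith [mul_pos (by linarith : (0 : ℝ) < k) hn0]
  calc _ ≤ _ := softRisk_zero_level_le hg hx
    _ ≤ M0 * (2 ^ M0 * Real.exp 1) * (y * q) *
        ((C * q) ^ (M0 + 1) * weight c1 c2 (max (Real.exp 1) (Real.log (1 / y)))) := by
        have := weight_pos (c1 := c1) (c2 := c2) (le_max_left (Real.exp 1) (xi α n k ^ 2))
        gcongr
    _ = M0 * (2 ^ M0 * Real.exp 1) * C ^ (M0 + 1) * (y * (q ^ (M0 + 2) *
          weight c1 c2 (max (Real.exp 1) (Real.log (1 / y))))) := by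
        have : q ^ (M0 + 2) = q ^ (M0 + 1) * q := by
          rw [← Real.rpow_add_one (by linarith)]; ring_nf
        rw [Real.mul_rpow (by linarith) (by linarith), this]
        ring
    _ ≤ max 1 (M0 * (2 ^ M0 * Real.exp 1) * C ^ (M0 + 1)) * (y * (q ^ (M0 + 2) *
          weight c1 c2 (max (Real.exp 1) (Real.log (1 / y))))) := by
        gcongr
        exact le_max_right _ _
    _ = _ := by ring

lemma log_nat_pos {n : ℕ} (hn : 2 ≤ n) : 0 < Real.log n :=
  Real.log_pos (by exact_mod_cast (by omega : 1 < n))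

lemma logPlus_pos (x : ℝ) : 0 < logPlus x := lt_of_lt_of_le one_pos (le_max_left _ _)

lemma L2_pos {n : ℕ} (hn : 2 ≤ n) {δ c1 c2 : ℝ} (hδ : 0 ≤ δ) : 0 < L2 n δ c1 c2 := by
  have h := log_nat_pos hn
  have h2 := logPlus_pos (Real.log n)
  unfold L2
  positivity

lemma tau2_pos {n : ℕ} (hn : 2 ≤ n) {δ c1 c2 : ℝ} (hδ : 0 ≤ δ) : 0 < tau2 n δ c1 c2 := by
  have h0 : (0 : ℝ) < n := by exact_mod_cast (by omega : 0 < n)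
  exact div_pos (L2_pos hn hδ) (Real.rpow_pos_of_pos h0 _)

/-- The second summand of `L2` suffices: 1 - c₂ ≥ -c₂ and the iterated logarithm is at least 1.
Since n ≥ 2, e ∨ log n is at most (e/log 2) log n. -/
lemma weight_rpow_le_L2 (A : ℝ) : ∃ E : ℝ, 0 < E ∧ ∀ (n : ℕ) (δ c1 c2 : ℝ), 2 ≤ n → 0 ≤ δ → δ ≤ A →
    0 < c1 → c1 ≤ 2 →
    weight c1 c2 (max (Real.exp 1) (Real.log n)) ^ (1 + δ) *
      (max (Real.exp 1) (Real.log n)) ^ (3 * δ / 2) ≤ E * L2 n δ c1 c2 := by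
  set s : ℝ := Real.exp 1 / Real.log 2
  have hlog2 : 0 < Real.log 2 := Real.log_pos one_lt_two
  have he1 := Real.exp_pos 1
  have hs1 : 1 ≤ s := by
    rw [one_le_div hlog2]
    linarith [Real.add_one_le_exp (1 : ℝ), Real.log_le_sub_one_of_pos (zero_lt_two' ℝ)]
  refine ⟨s ^ (3 / 2 + 3 / 2 * (1 + A)), by positivity, fun n δ c1 c2 hn hδ hA hc1 hc1' => ?_⟩
  set u := Real.log n
  have hu : 0 < u := log_nat_pos hn
  have hu2 : Real.log 2 ≤ u := Real.log_le_log (by norm_num) (by exact_mod_cast hn)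
  set L := max (Real.exp 1) u
  have hL : Real.exp 1 ≤ L := le_max_left _ _
  have hL0 := pos_of_exp_le hL
  have hLs : L ≤ s * u := by
    refine max_le ?_ (le_mul_of_one_le_left hu.le hs1)
    rw [div_mul_eq_mul_div, le_div_iff₀ hlog2]
    gcongr
  have hLL := one_le_log_of_exp_le hL
  have hlp : logPlus u = Real.log L := by
    unfold logPlus
    rcases le_total (Real.exp 1) u with h | h
    · rw [show L = u from max_eq_right h, max_eq_right (one_le_log_of_exp_le h)]
    · rw [show L = Real.exp 1 from max_eq_left h, Real.log_exp, max_eq_left]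
      rw [Real.log_le_iff_le_exp hu]; exact h
  set v := Real.log L
  have hv : 0 < v := by linarith
  set r : ℝ := -(3 / 2) + (3 - c1) / 2 * (1 + δ)
  have hr : |r| ≤ 3 / 2 + 3 / 2 * (1 + A) := by
    refine (abs_add_le _ _).trans ?_
    rw [abs_neg, abs_of_pos (by norm_num : (0 : ℝ) < 3 / 2), abs_of_nonneg
      (mul_nonneg (by linarith) (by linarith))]
    have : (3 - c1) / 2 * (1 + δ) ≤ 3 / 2 * (1 + A) := by gcongr; linarith
    linarith
  have h1 : L ^ r ≤ s ^ (3 / 2 + 3 / 2 * (1 + A)) * u ^ r :=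
    rpow_le_of_comparable hL0 hu hs1 hLs
      ((le_max_right _ _).trans (le_mul_of_one_le_left hL0.le hs1)) hr
  have h2 : u ^ r * (v ^ (-c2)) ^ (1 + δ) ≤ L2 n δ c1 c2 := by
    have e : u ^ r * (v ^ (-c2)) ^ (1 + δ) =
        u ^ (-(3 / 2) : ℝ) * (u ^ ((3 - c1) / 2) * v ^ (-c2)) ^ (1 + δ) := by
      rw [Real.mul_rpow (by positivity) (by positivity), ← Real.rpow_mul hu.le, Real.rpow_add hu]
      ring
    rw [e]
    change _ ≤ u ^ (-(3 / 2) : ℝ) * (δ * u ^ ((5 - c1) / 2) / (logPlus u) ^ c2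
      + u ^ ((3 - c1) / 2) / (logPlus u) ^ (c2 - 1)) ^ (1 + δ)
    rw [hlp]
    gcongr
    have h3 : v ^ (-c2) ≤ (v ^ (c2 - 1))⁻¹ := by
      rw [← Real.rpow_neg hv.le]
      exact Real.rpow_le_rpow_of_exponent_le hLL (by linarith)
    have h4 : 0 ≤ δ * u ^ ((5 - c1) / 2) / v ^ c2 := by positivity
    rw [div_eq_mul_inv (u ^ ((3 - c1) / 2))]
    have h5 : u ^ ((3 - c1) / 2) * v ^ (-c2) ≤ u ^ ((3 - c1) / 2) * (v ^ (c2 - 1))⁻¹ := by gcongr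
    linarith
  have e2 : weight c1 c2 L ^ (1 + δ) * L ^ (3 * δ / 2) = L ^ r * (v ^ (-c2)) ^ (1 + δ) := by
    rw [weight, Real.div_rpow (by positivity) (by positivity), ← Real.rpow_mul hL0.le, div_mul_eq_mul_div,
      mul_div_assoc, ← Real.rpow_sub hL0, mul_comm]
    congr 2
    ring
  rw [e2]
  calc _ ≤ s ^ (3 / 2 + 3 / 2 * (1 + A)) * u ^ r * (v ^ (-c2)) ^ (1 + δ) := by gcongr
    _ = s ^ (3 / 2 + 3 / 2 * (1 + A)) * (u ^ r * (v ^ (-c2)) ^ (1 + δ)) := by ring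
    _ ≤ _ := by gcongr

/-- The case y = 1/n, where the factor √(1+δ) is exploited: the risk at g(ξ_k) is raised to the
power 1+δ, and (1+g(ξ_k))^{3δ} costs a power of e ∨ log n because g(ξ_k)² ≤ ξ_k². -/
lemma softRisk_sqrt_level_xi_le (α2' A M0 : ℝ) (h0 : 0 < α2') : ∃ D : ℝ, 0 < D ∧
    ∀ (δ c1 c2 : ℝ) (g : ℝ → ℝ), 0 ≤ δ → δ ≤ A → LevelCondition M0 c1 c2 g →
    ∀ (α : ℝ) (n k : ℕ), α2' < α → α < 1 → 2 ≤ n → 1 ≤ k → k ≤ n →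
      softRisk 0 (√(1 + δ) * g (xi α n k)) ≤
        D * tau2 n δ c1 c2 * (k : ℝ) ^ ((M0 + 2) * (1 + A)) := by
  obtain ⟨C, hC, hcomp⟩ := xi_sq_comparable α2' h0
  obtain ⟨D1, hD1, hR⟩ := softRisk_level_xi_le α2' M0 h0
  obtain ⟨C2, hC2, hsq⟩ := softRisk_zero_sqrt_mul_le A
  obtain ⟨E, hE, hL2⟩ := weight_rpow_le_L2 A
  set D1' := max 1 D1
  refine ⟨C2 * D1' ^ (1 + A) * (4 * C) ^ (3 * A / 2) * E, by positivity,
    fun δ c1 c2 g hδ hδA hg α n k hα hα1 hn hk hkn => ?_⟩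
  have hM0 : 0 ≤ M0 := (abs_nonneg c2).trans hg.abs_c2_le
  have hn0 : (0 : ℝ) < n := by exact_mod_cast (by omega : 0 < n)
  have hk1 : (1 : ℝ) ≤ k := by exact_mod_cast hk
  have hn1 : (1 : ℝ) ≤ n := by exact_mod_cast (by omega : 1 ≤ n)
  have hnk : (n : ℝ) * (1 / n) ≤ k := by rw [mul_one_div_cancel hn0.ne']; exact hk1
  have hy1 : 1 / (n : ℝ) ≤ 1 := by rw [div_le_one hn0]; exact hn1
  have hR1 := hR c1 c2 g hg α n k (1 / n) hα hα1 hk hkn (by positivity) hy1 hnk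
  have hc := (hcomp α n k (1 / n) hα hα1 hk hkn (by positivity) hy1 hnk).1
  rw [one_div_one_div] at hR1 hc
  rw [mul_one_div_cancel hn0.ne', div_one] at hR1
  set L := max (Real.exp 1) (Real.log n)
  have hL : Real.exp 1 ≤ L := le_max_left _ _
  have hL0 := pos_of_exp_le hL
  have hw := weight_pos (c1 := c1) (c2 := c2) hL
  have hx : 0 < xi α n k := xi_pos (h0.trans hα) hα1 hk hkn
  set x := xi α n k
  have hgx := hg.nonneg x hx
  have hgle := hg.le_self x hx
  have hl1 := one_le_of_exp_le (le_max_left (Real.exp 1) (x ^ 2))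
  have hsqle : (1 + g x) ^ 2 ≤ 4 * C * L := by
    have h1 : (1 + g x) ^ 2 ≤ (1 + x) ^ 2 := by gcongr
    have h2 := le_max_right (Real.exp 1) (x ^ 2)
    nlinarith [sq_nonneg (1 - x)]
  have hpow : (1 + g x) ^ (3 * δ) ≤ (4 * C) ^ (3 * A / 2) * L ^ (3 * δ / 2) := by
    have e : (1 + g x) ^ (3 * δ) = ((1 + g x) ^ 2) ^ (3 * δ / 2) := by
      rw [← Real.rpow_natCast, ← Real.rpow_mul (by linarith)]
      congr 1; push_cast; ring
    rw [e]
    calc _ ≤ (4 * C * L) ^ (3 * δ / 2) := by gcongr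
      _ = (4 * C) ^ (3 * δ / 2) * L ^ (3 * δ / 2) := by
          rw [Real.mul_rpow (by linarith) hL0.le]
      _ ≤ _ := by
          gcongr
          linarith
  have hRpow : softRisk 0 (g x) ^ (1 + δ) ≤ D1' ^ (1 + A) * (1 / n) ^ (1 + δ) *
      (k : ℝ) ^ ((M0 + 2) * (1 + A)) * weight c1 c2 L ^ (1 + δ) := by
    calc _ ≤ (D1' * (1 / n) * (k : ℝ) ^ (M0 + 2) * weight c1 c2 L) ^ (1 + δ) := by
          refine Real.rpow_le_rpow (softRisk_zero_nonneg _) (hR1.trans ?_) (by linarith)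
          gcongr
          exact le_max_right _ _
      _ = D1' ^ (1 + δ) * (1 / n) ^ (1 + δ) * ((k : ℝ) ^ ((M0 + 2) * (1 + δ))) *
            weight c1 c2 L ^ (1 + δ) := by
          rw [Real.mul_rpow (by positivity) hw.le, Real.mul_rpow (by positivity) (by positivity),
            Real.mul_rpow (by positivity) (by positivity), ← Real.rpow_mul (by linarith)]
      _ ≤ _ := by
          have : 1 ≤ D1' := le_max_left _ _
          gcongr
  calc _ ≤ C2 * softRisk 0 (g x) ^ (1 + δ) * (1 + g x) ^ (3 * δ) := hsq (g x) δ hgx hδ hδA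
    _ ≤ C2 * (D1' ^ (1 + A) * (1 / n) ^ (1 + δ) *
      (k : ℝ) ^ ((M0 + 2) * (1 + A)) * weight c1 c2 L ^ (1 + δ)) *
      ((4 * C) ^ (3 * A / 2) * L ^ (3 * δ / 2)) := by gcongr
    _ = C2 * D1' ^ (1 + A) * (4 * C) ^ (3 * A / 2) * ((1 / n) ^ (1 + δ) *
      (k : ℝ) ^ ((M0 + 2) * (1 + A))) * (weight c1 c2 L ^ (1 + δ) * L ^ (3 * δ / 2)) := by ring
    _ ≤ C2 * D1' ^ (1 + A) * (4 * C) ^ (3 * A / 2) * ((1 / n) ^ (1 + δ) *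
      (k : ℝ) ^ ((M0 + 2) * (1 + A))) * (E * L2 n δ c1 c2) := by
        exact mul_le_mul_of_nonneg_left (hL2 n δ c1 c2 hn hδ hδA hg.c1_pos hg.c1_le) (by positivity)
    _ = _ := by
        rw [tau2, Real.div_rpow zero_le_one hn0.le, Real.one_rpow]
        ring

/-! ### Noise at the step-up level. -/

/-- Pointwise majorant of `∑ s_{l_k}(z_i)²` at the random index `k` of the step-up level. -/
def noiseMajorant {n : ℕ} (θ : Fin n → ℝ) (α : ℝ) (l : ℕ → ℝ) (k0 : ℕ) (x : Fin n → ℝ) : ℝ :=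
  ∑ i, soft (l k0) (x i - θ i) ^ 2 + ∑ k ∈ Finset.Ioc k0 n, ∑ i,
    {x | k ≤ exceed x (xi α n k)}.indicator (fun x => soft (l k) (x i - θ i) ^ 2) x

/-- Levels decrease in k, so every k ≤ k0 has noise at most that at k0. For k > k0 ≥ 1 the default
is excluded, so the event k ≤ N(ξ_k) holds and the k-th summand alone suffices. -/
lemma sum_soft_le_noiseMajorant {n : ℕ} (θ : Fin n → ℝ) (α : ℝ) {l : ℕ → ℝ} {k0 k : ℕ}
    (hl : ∀ k, 1 ≤ k → k ≤ n → 0 ≤ l k)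
    (hanti : ∀ j k, 1 ≤ j → j ≤ k → k ≤ n → l k ≤ l j)
    (h1 : 1 ≤ k0) (hk0 : k0 ≤ n) (hk : 1 ≤ k) (hkn : k ≤ n) {x : Fin n → ℝ}
    (hx : k = 1 ∨ k ≤ exceed x (xi α n k)) :
    ∑ i, soft (l k) (x i - θ i) ^ 2 ≤ noiseMajorant θ α l k0 x := by
  have hnn : ∀ k, 0 ≤ ∑ i, {x | k ≤ exceed x (xi α n k)}.indicator
      (fun x => soft (l k) (x i - θ i) ^ 2) x := fun k =>
    Finset.sum_nonneg fun i _ => Set.indicator_nonneg (fun _ _ => sq_nonneg _) x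
  unfold noiseMajorant
  rcases le_or_gt k k0 with h | h
  · have h2 : ∑ i, soft (l k) (x i - θ i) ^ 2 ≤ ∑ i, soft (l k0) (x i - θ i) ^ 2 :=
      Finset.sum_le_sum fun i _ => soft_sq_anti (hl k0 h1 hk0) (hanti k k0 hk h hk0) _
    linarith [Finset.sum_nonneg fun k (_ : k ∈ Finset.Ioc k0 n) => hnn k]
  · have h3 : k ≤ exceed x (xi α n k) := hx.resolve_left (by omega)
    have h2 := Finset.single_le_sum (fun k _ => hnn k) (Finset.mem_Ioc.2 ⟨h, hkn⟩)
    have h4 : ∑ i, {x | k ≤ exceed x (xi α n k)}.indicator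
      (fun x => soft (l k) (x i - θ i) ^ 2) x = ∑ i, soft (l k) (x i - θ i) ^ 2 :=
      Finset.sum_congr rfl fun i _ => Set.indicator_of_mem (by exact h3) _
    have h5 : 0 ≤ ∑ i, soft (l k0) (x i - θ i) ^ 2 := Finset.sum_nonneg fun i _ => sq_nonneg _
    linarith

lemma integrable_soft_eval {n : ℕ} (θ : Fin n → ℝ) {lam : ℝ} (hl : 0 ≤ lam) (i : Fin n) :
    Integrable (fun x : Fin n → ℝ => soft lam (x i - θ i) ^ 2) (obsLaw θ) :=
  integrable_comp_eval θ i (integrable_soft_sub_sq hl (θ i))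

lemma measurableSet_le_exceed {n : ℕ} (k : ℕ) (s : ℝ) :
    MeasurableSet {x : Fin n → ℝ | k ≤ exceed x s} :=
  measurableSet_le measurable_const (measurable_exceed s)

lemma measurableSet_exceed_le {n : ℕ} (k : ℕ) (s : ℝ) :
    MeasurableSet {x : Fin n → ℝ | exceed x s ≤ k} :=
  measurableSet_le (measurable_exceed s) measurable_const

lemma integrable_noiseMajorant {n : ℕ} (θ : Fin n → ℝ) (α : ℝ) {l : ℕ → ℝ} {k0 : ℕ}
    (hl : ∀ k, 1 ≤ k → k ≤ n → 0 ≤ l k) (h1 : 1 ≤ k0) (hk0 : k0 ≤ n) :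
    Integrable (noiseMajorant θ α l k0) (obsLaw θ) := by
  refine (integrable_finsetSum _ fun i _ => integrable_soft_eval θ (hl k0 h1 hk0) i).add
    (integrable_finsetSum _ fun k hk => integrable_finsetSum _ fun i _ => ?_)
  have := Finset.mem_Ioc.1 hk
  exact (integrable_soft_eval θ (hl k (by omega) this.2) i).indicator (measurableSet_le_exceed k _)

lemma integral_noiseMajorant_le {n : ℕ} (θ : Fin n → ℝ) (α : ℝ) {l : ℕ → ℝ} {k0 : ℕ}
    (hl : ∀ k, 1 ≤ k → k ≤ n → 0 ≤ l k) (h1 : 1 ≤ k0) (hk0 : k0 ≤ n) {a : ℝ} (ha : 0 ≤ a) :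
    ∫ x, noiseMajorant θ α l k0 x ∂(obsLaw θ) ≤ n * softRisk 0 (l k0) +
      ∑ k ∈ Finset.Ioc k0 n, n * (softRisk 0 (l k) *
        Real.exp (a - a * k + (Real.exp a - 1) * meanExceed θ (xi α n k))) := by
  have hi1 := fun i (_ : i ∈ Finset.univ) => integrable_soft_eval θ (hl k0 h1 hk0) i
  have hi2 : ∀ k ∈ Finset.Ioc k0 n, ∀ i ∈ Finset.univ, Integrable
      ({x | k ≤ exceed x (xi α n k)}.indicator (fun x => soft (l k) (x i - θ i) ^ 2))
      (obsLaw θ) := fun k hk i _ => by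
    have := Finset.mem_Ioc.1 hk
    exact (integrable_soft_eval θ (hl k (by omega) this.2) i).indicator
      (measurableSet_le_exceed k _)
  unfold noiseMajorant
  rw [integral_add (integrable_finsetSum _ hi1)
    (integrable_finsetSum _ fun k hk => integrable_finsetSum _ (hi2 k hk)),
    integral_finsetSum _ hi1,
    integral_finsetSum _ fun k hk => integrable_finsetSum _ (hi2 k hk)]
  refine add_le_add (le_of_eq ?_) (Finset.sum_le_sum fun k hk => ?_)
  · have : ∀ i, ∫ x : Fin n → ℝ, soft (l k0) (x i - θ i) ^ 2 ∂(obsLaw θ) = softRisk 0 (l k0) :=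
      fun i => by
        rw [integral_comp_eval θ i (f := fun y => soft (l k0) (y - θ i) ^ 2)
          (integrable_soft_sub_sq (hl k0 h1 hk0) (θ i)), integral_soft_sub_sq]
    simp [this]
  · rw [integral_finsetSum _ (hi2 k hk)]
    have := Finset.mem_Ioc.1 hk
    refine (Finset.sum_le_card_nsmul _ _ _ fun i _ =>
      integral_soft_indicator_exceed_le θ ha (xi α n k) i k (hl k (by omega) this.2)).trans ?_
    simp

lemma meanExceed_le {n : ℕ} (θ : Fin n → ℝ) {s : ℝ} (hs : 0 ≤ s) :
    meanExceed θ s ≤ n * (2 * Phi (-s)) + ∑ i, min (θ i ^ 2) 1 := by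
  have := Finset.sum_le_sum fun i (_ : i ∈ Finset.univ) => exceedProb_le (θ i) s hs
  rw [Finset.sum_add_distrib] at this
  simpa [meanExceed] using this

/-- Expected noise above the random level, when the number of relevant signals is at most
`2 n y`. -/
lemma integral_noiseMajorant_le_of_growth (α1' : ℝ) (h0 : 0 < α1') (h1 : α1' < 1) (q : ℕ) :
    ∃ C : ℝ, 0 < C ∧ ∀ (n : ℕ) (θ : Fin n → ℝ) (α y D : ℝ) (l : ℕ → ℝ), 1 ≤ n → 0 < α → α < α1' →
      1 ≤ n * y → y ≤ 1 → 0 ≤ D → (∀ k, 1 ≤ k → k ≤ n → 0 ≤ l k) →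
      ∑ i, min (θ i ^ 2) 1 ≤ 2 * (n * y) →
      (∀ k : ℕ, 1 ≤ k → k ≤ n → n * y ≤ k → n * softRisk 0 (l k) ≤ D * (k / (n * y)) ^ q) →
      ∃ k0, 1 ≤ k0 ∧ k0 ≤ n ∧ ∫ x, noiseMajorant θ α l k0 x ∂(obsLaw θ) ≤ C * D := by
  -- For k ≥ Kw, where w = ny, K makes the signal part 2w at most (1-α₁')k/2, so the mean of N(ξ_k)
  -- is at most γk. The tilt e^a = 1/γ is the Chernoff optimum, with rate a - (1-γ) = -log γ - (1-γ)
  -- > 0.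
  set γ : ℝ := (1 + α1') / 2 with hγ
  have hγ0 : 0 < γ := by linarith
  have hγ1 : γ < 1 := by linarith
  set K : ℝ := 4 / (1 - α1') with hK
  have hK4 : 4 ≤ K := by rw [hK, le_div_iff₀ (by linarith)]; linarith
  set a : ℝ := -Real.log γ with ha
  have hca : 0 < a - (1 - γ) := by
    have := Real.log_lt_sub_one_of_pos hγ0 hγ1.ne
    linarith
  set c : ℝ := a - (1 - γ) with hc
  have ha0 : 0 ≤ a := by linarith
  have hea : Real.exp a = γ⁻¹ := by rw [ha, Real.exp_neg, Real.exp_log hγ0]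
  have hsum := Real.summable_pow_mul_exp_neg_nat_mul q hca
  set S : ℝ := ∑' k : ℕ, (k : ℝ) ^ q * Real.exp (-c * k)
  have hS : 0 ≤ S := tsum_nonneg fun k => by positivity
  refine ⟨(K + 1) ^ q + Real.exp a * S, by positivity, fun n θ α y D l hn hα hα1 hny hy1 hD hl hθ hR => ?_⟩
  have hn0 : (0 : ℝ) < n := by exact_mod_cast hn
  set w : ℝ := n * y with hw
  have hw0 : 0 < w := by linarith
  have hwn : w ≤ n := by rw [hw]; nlinarith
  set k0 := min n ⌈K * w⌉₊ with hk0
  have hceil : 1 ≤ ⌈K * w⌉₊ := Nat.one_le_ceil_iff.2 (by positivity)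
  have hk01 : 1 ≤ k0 := le_min hn hceil
  have hk0n : k0 ≤ n := min_le_left _ _
  refine ⟨k0, hk01, hk0n, (integral_noiseMajorant_le θ α hl hk01 hk0n ha0).trans ?_⟩
  have hwk0 : w ≤ k0 := by
    rw [hk0, Nat.cast_min]
    refine le_min hwn (le_trans ?_ (Nat.le_ceil _))
    nlinarith
  have hk0le : (k0 : ℝ) / w ≤ K + 1 := by
    rw [div_le_iff₀ hw0]
    have e1 : (k0 : ℝ) ≤ ⌈K * w⌉₊ := by exact_mod_cast min_le_right _ _
    have e2 := Nat.ceil_lt_add_one (by positivity : 0 ≤ K * w)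
    nlinarith
  have t1 : n * softRisk 0 (l k0) ≤ D * (K + 1) ^ q :=
    (hR k0 hk01 hk0n hwk0).trans (by gcongr)
  have t2 : ∀ k ∈ Finset.Ioc k0 n, n * (softRisk 0 (l k) *
      Real.exp (a - a * k + (Real.exp a - 1) * meanExceed θ (xi α n k))) ≤
      D * Real.exp a * ((k : ℝ) ^ q * Real.exp (-c * k)) := by
    intro k hk
    obtain ⟨hk1, hkn⟩ := Finset.mem_Ioc.1 hk
    have hk1' : 1 ≤ k := by omega
    have hkr : (0 : ℝ) < k := by exact_mod_cast hk1'
    have hkw : K * w ≤ k := by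
      have : ⌈K * w⌉₊ ≤ k := by
        rcases min_choice n ⌈K * w⌉₊ with h | h
        -- If the cap k0 = n is active, no k lies in (k0, n].
        · exact absurd (hk0.trans h) (by omega)
        · exact (hk0.trans h) ▸ hk1.le
      exact (Nat.le_ceil _).trans (by exact_mod_cast this)
    have hwk : w ≤ k := by nlinarith
    have hm : meanExceed θ (xi α n k) ≤ γ * k := by
      have e := meanExceed_le θ (xi_pos hα (hα1.trans h1) hk1' hkn).le
      rw [Phi_neg_xi hα (hα1.trans h1) hk1' (by omega)] at e
      rw [show n * (2 * (α * k / (2 * n))) = α * k by field_simp] at e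
      have e2 : 2 * w ≤ (1 - α1') / 2 * k := by
        have : (1 - α1') / 2 * (K * w) = 2 * w := by
          rw [hK]
          have : 1 - α1' ≠ 0 := by linarith
          field_simp; norm_num
        rw [← this]
        exact mul_le_mul_of_nonneg_left hkw (by linarith)
      have e3 : α * k ≤ α1' * k := by gcongr
      rw [hγ]; linarith
    have hexp : Real.exp (a - a * k + (Real.exp a - 1) * meanExceed θ (xi α n k)) ≤
        Real.exp a * Real.exp (-c * k) := by
      rw [← Real.exp_add]
      refine Real.exp_le_exp.2 ?_
      have : (Real.exp a - 1) * meanExceed θ (xi α n k) ≤ (1 - γ) * k := by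
        calc _ ≤ (Real.exp a - 1) * (γ * k) :=
              mul_le_mul_of_nonneg_left hm (by linarith [Real.add_one_le_exp a])
          _ = _ := by rw [hea]; field_simp
      rw [hc]; linarith
    have hkpow : n * softRisk 0 (l k) ≤ D * (k : ℝ) ^ q := by
      refine (hR k hk1' hkn hwk).trans ?_
      gcongr
      exact div_le_self hkr.le hny
    calc _ = n * softRisk 0 (l k) *
          Real.exp (a - a * k + (Real.exp a - 1) * meanExceed θ (xi α n k)) := by ring
      _ ≤ D * (k : ℝ) ^ q * (Real.exp a * Real.exp (-c * k)) := by
          gcongr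
      _ = _ := by ring
  have t3 : ∑ k ∈ Finset.Ioc k0 n, (k : ℝ) ^ q * Real.exp (-c * k) ≤ S :=
    hsum.sum_le_tsum _ fun k _ => by positivity
  calc _ ≤ D * (K + 1) ^ q + ∑ k ∈ Finset.Ioc k0 n,
        D * Real.exp a * ((k : ℝ) ^ q * Real.exp (-c * k)) :=
        add_le_add t1 (Finset.sum_le_sum t2)
    _ ≤ D * (K + 1) ^ q + D * Real.exp a * S := by
        rw [← Finset.mul_sum]; gcongr
    _ = _ := by ring

/-! ### Surrogate risk and its near minimizers. -/

lemma rho_empPrior {n : ℕ} (hn : 1 ≤ n) (θ : Fin n → ℝ) (lam : ℝ) :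
    n * rho (empPrior θ) lam = ∑ i, min (θ i ^ 2) (lam ^ 2) := by
  have hn0 : (n : ℝ) ≠ 0 := by positivity
  rw [rho, empPrior, integral_smul_measure, integral_finsetSum_measure]
  · simp [hn0]
  · intro i _
    exact integrable_dirac (by simp)

lemma rho_nonneg (G : Measure ℝ) (lam : ℝ) : 0 ≤ rho G lam :=
  integral_nonneg fun u => le_min (sq_nonneg u) (sq_nonneg lam)

lemma surrogateRisk_nonneg {B0 : ℝ} (hB : 0 ≤ B0) (G : Measure ℝ) (lam : ℝ) :
    0 ≤ surrogateRisk B0 G lam :=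
  add_nonneg (rho_nonneg G lam) (mul_nonneg hB (Phi_nonneg _))

lemma etaStar_nonneg {B0 : ℝ} (hB : 0 ≤ B0) (G : Measure ℝ) : 0 ≤ etaStar B0 G :=
  Real.sInf_nonneg (by rintro _ ⟨lam, -, rfl⟩; exact surrogateRisk_nonneg hB G lam)

lemma etaStar_le {B0 : ℝ} (hB : 0 ≤ B0) (G : Measure ℝ) {lam : ℝ} (hl : 0 ≤ lam) :
    etaStar B0 G ≤ surrogateRisk B0 G lam :=
  csInf_le ⟨0, by rintro _ ⟨lam, -, rfl⟩; exact surrogateRisk_nonneg hB G lam⟩ ⟨lam, hl, rfl⟩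

lemma exists_surrogateRisk_lt (B0 : ℝ) (G : Measure ℝ) {ε : ℝ} (hε : 0 < ε) :
    ∃ lam : ℝ, 0 ≤ lam ∧ surrogateRisk B0 G lam < etaStar B0 G + ε := by
  obtain ⟨_, ⟨lam, hl, rfl⟩, h⟩ := exists_lt_of_csInf_lt
    (s := (fun lam => surrogateRisk B0 G lam) '' Set.Ici 0) ⟨_, 0, Set.self_mem_Ici, rfl⟩
    (lt_add_of_pos_right (etaStar B0 G) hε)
  exact ⟨lam, hl, h⟩

/-- Number of means of absolute value larger than `lam`. -/
def signalCount {n : ℕ} (θ : Fin n → ℝ) (lam : ℝ) : ℝ := ∑ i, if lam < |θ i| then (1 : ℝ) else 0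

lemma signalCount_le {n : ℕ} (θ : Fin n → ℝ) (lam : ℝ) : signalCount θ lam ≤ n := by
  refine (Finset.sum_le_card_nsmul _ _ 1 fun i _ => ?_).trans (by simp)
  split_ifs <;> norm_num

lemma signalCount_mul_sq_le {n : ℕ} (hn : 1 ≤ n) (θ : Fin n → ℝ) {lam : ℝ} (hl : 0 ≤ lam) :
    signalCount θ lam * lam ^ 2 ≤ n * rho (empPrior θ) lam := by
  rw [rho_empPrior hn, signalCount, Finset.sum_mul]
  refine Finset.sum_le_sum fun i _ => ?_
  split_ifs with h
  · rw [one_mul, ← sq_abs (θ i)]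
    exact le_min (by gcongr) le_rfl
  · rw [zero_mul]; exact le_min (sq_nonneg _) (sq_nonneg _)

/-- Only means beyond lam feel the larger level, and (lam + 1/lam)² ≤ lam² + 3 when lam ≥ 1. -/
lemma rho_add_inv_le {n : ℕ} (hn : 1 ≤ n) (θ : Fin n → ℝ) {lam : ℝ} (hl : 1 ≤ lam) :
    n * rho (empPrior θ) (lam + 1 / lam) ≤ n * rho (empPrior θ) lam + 3 * signalCount θ lam := by
  rw [rho_empPrior hn, rho_empPrior hn, signalCount, Finset.mul_sum, ← Finset.sum_add_distrib]
  refine Finset.sum_le_sum fun i _ => ?_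
  have h1 : (lam + 1 / lam) ^ 2 ≤ lam ^ 2 + 3 := by
    have e : (lam + 1 / lam) ^ 2 = lam ^ 2 + 2 + (1 / lam) ^ 2 := by
      have : lam ≠ 0 := by linarith
      field_simp; ring
    have : 1 / lam ≤ 1 := by rw [div_le_one (by linarith)]; exact hl
    have : (1 / lam) ^ 2 ≤ 1 := pow_le_one₀ (by positivity) this
    linarith
  split_ifs with h
  · have h2 : lam ^ 2 ≤ θ i ^ 2 := by rw [← sq_abs (θ i)]; gcongr
    rw [min_eq_right h2]
    exact (min_le_right _ _).trans (by linarith)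
  · have h2 : θ i ^ 2 ≤ lam ^ 2 := by
      rw [← sq_abs (θ i)]
      have := abs_nonneg (θ i)
      push Not at h
      gcongr
    rw [min_eq_left h2]
    exact (min_le_left _ _).trans (by linarith)

lemma L1_pos (η : ℝ) : 0 < L1 η := pos_of_exp_le (le_max_left _ _)

lemma L1_eq_exp_one {η : ℝ} (hη : 1 / 8 ≤ η) : L1 η = Real.exp 1 := by
  refine max_eq_left ?_
  have hη0 : 0 < η := by linarith
  have h8 : Real.log (1 / η) ≤ Real.log 8 := by
    refine Real.log_le_log (by positivity) ?_
    rw [div_le_iff₀ hη0]; linarith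
  have : Real.log 8 = 3 * Real.log 2 := by
    rw [show (8 : ℝ) = 2 ^ 3 by norm_num, Real.log_pow]; norm_num
  linarith [Real.log_two_lt_d9, Real.exp_one_gt_d9]

lemma lt_Phi_neg_one : 1 / 32 < Phi (-1) := by
  have h := Phi_neg_lower 1 zero_le_one
  refine lt_of_lt_of_le ?_ h
  have hs : √(2 * Real.pi) < 3 := by
    rw [Real.sqrt_lt' (by norm_num)]; linarith [Real.pi_lt_four]
  have hs0 : 0 < √(2 * Real.pi) := by positivity
  have h1 : 1 / 3 < (√(2 * Real.pi))⁻¹ := by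
    rw [one_div]; exact inv_strictAnti₀ hs0 hs
  have h2 : (9 : ℝ) / 25 < Real.exp (-1) := by
    have := Real.exp_neg_one_gt_d9; linarith
  rw [one_pow]
  have h3 : (9 : ℝ) / 25 * (9 / 25) < Real.exp (-1) * Real.exp (-1) := by gcongr
  have h4 : (1 : ℝ) / 3 * (9 / 25 * (9 / 25)) < (√(2 * Real.pi))⁻¹ * (Real.exp (-1) * Real.exp (-1)) :=
    by gcongr
  rw [← mul_assoc] at h4
  linarith

/-- Properties of a near minimizer of the surrogate risk. -/
lemma exists_near_minimizer : ∃ C : ℝ, 0 < C ∧ ∀ (n : ℕ) (θ : Fin n → ℝ) (B0 η ε : ℝ), 1 ≤ n →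
    8 ≤ B0 → η = etaStar B0 (empPrior θ) → 0 < ε → ε ≤ 1 / 8 → (0 < η → ε ≤ η) →
    ∃ lam : ℝ, 0 ≤ lam ∧ rho (empPrior θ) lam ≤ η + ε ∧
      (η ≤ 1 / 8 → ∑ i, min (θ i ^ 2) 1 ≤ n * (η + ε)) ∧
      Phi (-lam) ≤ C * (η / L1 η + ε) ∧ signalCount θ lam ≤ C * (η / L1 η + ε) * n := by
  set c : ℝ := (√(2 * Real.pi))⁻¹ * Real.exp (-1)
  have hc : 0 < c := by positivity
  set C1 : ℝ := Real.exp 1 + 1 + |Real.log (1 / c)| with hC1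
  have hC1e : Real.exp 1 ≤ C1 := by linarith [abs_nonneg (Real.log (1 / c))]
  have he := Real.exp_pos 1
  have he1 : 1 ≤ Real.exp 1 := Real.one_le_exp zero_le_one
  refine ⟨2 * C1 + 8 * Real.exp 1, by positivity, fun n θ B0 η ε hn hB hη hε hε8 hεη => ?_⟩
  have hn0 : (0 : ℝ) < n := by exact_mod_cast hn
  have hη0 : 0 ≤ η := hη ▸ etaStar_nonneg (by linarith) _
  have hL := L1_pos η
  have hLe : Real.exp 1 ≤ L1 η := le_max_left _ _
  obtain ⟨lam, hl, hlam⟩ := exists_surrogateRisk_lt B0 (empPrior θ) hε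
  rw [← hη] at hlam
  have hmin := etaStar_le (by linarith : 0 ≤ B0) (empPrior θ) (lam := lam + 1 / lam)
    (by positivity)
  rw [← hη] at hmin
  unfold surrogateRisk at hlam hmin
  have hr := rho_nonneg (empPrior θ) lam
  have hP := Phi_nonneg (-lam)
  have hBP : 8 * Phi (-lam) ≤ B0 * Phi (-lam) := by gcongr
  have hrat : 0 ≤ η / L1 η := by positivity
  refine ⟨lam, hl, by nlinarith, ?_⟩
  rcases lt_or_ge lam 1 with h1 | h1
  · have hP1 : Phi (-1) ≤ Phi (-lam) := Phi_mono (by linarith)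
    have h2 := lt_Phi_neg_one
    have hη8 : 1 / 8 < η := by linarith
    have hL1 := L1_eq_exp_one hη8.le
    have hone : 1 ≤ (2 * C1 + 8 * Real.exp 1) * (η / L1 η + ε) := by
      rw [hL1]
      have : 1 ≤ 8 * Real.exp 1 * (η / Real.exp 1) := by
        field_simp; linarith
      have h3 : 0 ≤ η / Real.exp 1 := by positivity
      have h4 : 0 ≤ 2 * C1 := by linarith
      nlinarith [mul_nonneg h4 (add_nonneg h3 hε.le)]
    refine ⟨fun h => by linarith, (Phi_le_one _).trans hone, ?_⟩
    exact (signalCount_le θ lam).trans (le_mul_of_one_le_left hn0.le hone)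
  have hl0 : 0 < lam := by linarith
  have hsq1 : 1 ≤ lam ^ 2 := by nlinarith
  -- For η > 0, Φ(-lam) ≤ η forces lam² to be at least of order `L1 η`. For η = 0 only ε/lam² ≤ ε is
  -- left.
  have hquot : (η + ε) / lam ^ 2 ≤ 2 * C1 * (η / L1 η) + ε := by
    rcases hη0.eq_or_lt with h0 | h0
    · rw [← h0]; simp
      exact div_le_self hε.le hsq1
    have hlow := Phi_neg_lower lam hl
    have h2 : c * Real.exp (-lam ^ 2) ≤ η := by linarith [hεη h0]
    have h3 := Real.log_le_log (by positivity) h2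
    rw [Real.log_mul hc.ne' (Real.exp_pos _).ne', Real.log_exp] at h3
    have h4 : L1 η ≤ C1 * lam ^ 2 := by
      refine max_le (by nlinarith) ?_
      have h5 : Real.log (1 / c) = -Real.log c := by rw [one_div, Real.log_inv]
      have h6 := le_abs_self (Real.log (1 / c))
      rw [one_div, Real.log_inv]
      nlinarith [abs_nonneg (Real.log (1 / c))]
    have h5 : (η + ε) / lam ^ 2 ≤ 2 * C1 * (η / L1 η) := by
      rw [← mul_div_assoc, div_le_div_iff₀ (by positivity) hL]
      have := hεη h0
      nlinarith [mul_le_mul_of_nonneg_left h4 h0.le]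
    linarith
  have hsig : signalCount θ lam ≤ n * (2 * C1 * (η / L1 η) + ε) := by
    have h2 := signalCount_mul_sq_le hn θ hl
    have h3 : signalCount θ lam ≤ n * ((η + ε) / lam ^ 2) := by
      rw [← mul_div_assoc, le_div_iff₀ (by positivity)]
      refine h2.trans ?_
      gcongr
      nlinarith
    exact h3.trans (by gcongr)
  refine ⟨fun _ => ?_, ?_, ?_⟩
  · calc _ ≤ ∑ i, min (θ i ^ 2) (lam ^ 2) :=
          Finset.sum_le_sum fun i _ => min_le_min_left _ hsq1
      _ = n * rho (empPrior θ) lam := (rho_empPrior hn θ lam).symm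
      _ ≤ _ := by gcongr; nlinarith
  · have hdec : Phi (-(lam + 1 / lam)) ≤ Phi (-lam) / 2 := by
      refine (Phi_neg_add_le lam (1 / lam) (by positivity)).trans ?_
      rw [mul_one_div_cancel hl0.ne']
      have h2 : Real.exp (-1 - (1 / lam) ^ 2 / 2) ≤ Real.exp (-1) :=
        Real.exp_le_exp.2 (by linarith [sq_nonneg (1 / lam)])
      have h3 : Real.exp (-1) ≤ 1 / 2 := by linarith [Real.exp_neg_one_lt_d9]
      have h4 := mul_le_mul_of_nonneg_right (h2.trans h3) hP
      linarith
    have h2 := rho_add_inv_le hn θ h1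
    have h3 : B0 * Phi (-(lam + 1 / lam)) ≤ B0 * (Phi (-lam) / 2) := by gcongr
    have h4 : rho (empPrior θ) (lam + 1 / lam) ≤
        rho (empPrior θ) lam + 3 * (2 * C1 * (η / L1 η) + ε) := by
      have : n * rho (empPrior θ) (lam + 1 / lam) ≤
        n * (rho (empPrior θ) lam + 3 * (2 * C1 * (η / L1 η) + ε)) := by linarith
      exact le_of_mul_le_mul_left this hn0
    have g1 := mul_nonneg he.le hrat
    have g2 := mul_nonneg he.le hε.le
    have g3 := mul_nonneg (by linarith : 0 ≤ C1) hrat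
    have g4 := mul_nonneg (by linarith : 0 ≤ C1 - 1) hε.le
    linarith
  · rw [mul_comm]
    refine hsig.trans ?_
    have h1 : 2 * C1 * (η / L1 η) + ε ≤ (2 * C1 + 8 * Real.exp 1) * (η / L1 η + ε) := by
      have g1 := mul_nonneg he.le hrat
      have g2 := mul_nonneg he.le hε.le
      have g4 := mul_nonneg (by linarith : 0 ≤ C1 - 1) hε.le
      linarith
    calc _ ≤ n * ((2 * C1 + 8 * Real.exp 1) * (η / L1 η + ε)) := by gcongr
      _ = _ := by ring

/-! ### Bias at the step-down level. -/

/-- Pointwise bound for `μ_k / k` at the random index `k` of the step-down level. -/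
def biasMajorant {n : ℕ} (θ : Fin n → ℝ) (α : ℝ) (x : Fin n → ℝ) : ℝ :=
  4 + ∑ k ∈ Finset.Icc 1 n, (if 4 * (k : ℝ) < meanExceed θ (xi α n k) then
    meanExceed θ (xi α n k) else 0) * {x | exceed x (xi α n k) ≤ k}.indicator (fun _ => 1) x

lemma sum_min_sq_max_le {n : ℕ} (hn : 1 ≤ n) (θ : Fin n → ℝ) {α : ℝ} (h0 : 0 < α) (h1 : α < 1)
    {lam : ℝ} (hl : 0 ≤ lam) (x : Fin n → ℝ) :
    ∑ i, min (θ i ^ 2) ((max lam (xiHat2 α x)) ^ 2) ≤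
      n * rho (empPrior θ) lam + 8 * n / α * Phi (-lam) * biasMajorant θ α x := by
  obtain ⟨k, hk, hkn, hx, e⟩ := xiHat2_mem h0 h1 hn x
  have hk0 : (0 : ℝ) < k := by exact_mod_cast hk
  have hn0 : (0 : ℝ) < n := by exact_mod_cast hn
  have hP := Phi_nonneg (-lam)
  rw [e, rho_empPrior hn]
  set m := meanExceed θ (xi α n k) with hm
  have hm0 : 0 ≤ m := meanExceed_nonneg _ _
  have h2 := Finset.sum_le_sum fun i (_ : i ∈ Finset.univ) =>
    min_sq_max_le (θ i) lam (xi α n k) hl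
  rw [Finset.sum_add_distrib, ← Finset.sum_mul, ← Finset.mul_sum] at h2
  change _ ≤ _ + 4 * m * _ at h2
  rw [Phi_neg_xi h0 h1 hk (by omega)] at h2
  have h3 : 4 * m * (Phi (-lam) / (α * k / (2 * n))) = 8 * n / α * Phi (-lam) * (m / k) := by
    field_simp; ring
  rw [h3] at h2
  have hnn : ∀ j ∈ Finset.Icc 1 n, 0 ≤ (if 4 * (j : ℝ) < meanExceed θ (xi α n j) then
      meanExceed θ (xi α n j) else 0) * {x | exceed x (xi α n j) ≤ j}.indicator
        (fun _ => (1 : ℝ)) x := fun j _ => by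
    refine mul_nonneg ?_ (Set.indicator_nonneg (fun _ _ => zero_le_one) _)
    split_ifs
    exacts [meanExceed_nonneg _ _, le_rfl]
  -- Either m ≤ 4k, or the k-th summand equals m because N(ξ_k) ≤ k at the selected index.
  have h4 : m / k ≤ biasMajorant θ α x := by
    unfold biasMajorant
    rcases le_or_gt m (4 * k) with h | h
    · rw [div_le_iff₀ hk0]
      have := Finset.sum_nonneg hnn
      nlinarith
    · have := Finset.single_le_sum hnn (Finset.mem_Icc.2 ⟨hk, hkn⟩)
      rw [← hm, if_pos h, Set.indicator_of_mem (by exact hx), mul_one] at this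
      have h5 : m / k ≤ m := div_le_self hm0 (by exact_mod_cast hk)
      linarith
  exact h2.trans (by gcongr)

lemma integrable_exceed_indicator {n : ℕ} (θ : Fin n → ℝ) (s : ℝ) (k : ℕ) :
    Integrable ({x | exceed x s ≤ k}.indicator (fun _ => (1 : ℝ))) (obsLaw θ) :=
  (integrable_const 1).indicator (measurableSet_exceed_le k s)

lemma integrable_biasMajorant {n : ℕ} (θ : Fin n → ℝ) (α : ℝ) :
    Integrable (biasMajorant θ α) (obsLaw θ) :=
  (integrable_const 4).add (integrable_finsetSum _ fun _ _ =>
    (integrable_exceed_indicator θ _ _).const_mul _)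

lemma sum_half_pow_le (n : ℕ) : ∑ k ∈ Finset.Icc 1 n, (1 / 2 : ℝ) ^ k ≤ 1 := by
  have h : ∑ k ∈ Finset.Icc 1 n, (1 / 2 : ℝ) ^ k = 1 - (1 / 2) ^ n := by
    induction n with
    | zero => simp
    | succ n ih => rw [Finset.sum_Icc_succ_top (by omega), ih]; ring
  rw [h]
  have : (0 : ℝ) ≤ (1 / 2) ^ n := by positivity
  linarith

lemma integral_biasMajorant_le {n : ℕ} (θ : Fin n → ℝ) (α : ℝ) :
    ∫ x, biasMajorant θ α x ∂(obsLaw θ) ≤ 12 := by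
  unfold biasMajorant
  have hi : ∀ k ∈ Finset.Icc 1 n, Integrable (fun x => (if 4 * (k : ℝ) < meanExceed θ (xi α n k) then
      meanExceed θ (xi α n k) else 0) * {x | exceed x (xi α n k) ≤ k}.indicator (fun _ => (1 : ℝ)) x)
      (obsLaw θ) := fun k _ => (integrable_exceed_indicator θ _ _).const_mul _
  rw [integral_add (integrable_const _) (integrable_finsetSum _ hi), integral_finsetSum _ hi]
  have h1 : ∀ k ∈ Finset.Icc 1 n, ∫ x, (if 4 * (k : ℝ) < meanExceed θ (xi α n k) then
      meanExceed θ (xi α n k) else 0) * {x | exceed x (xi α n k) ≤ k}.indicator (fun _ => (1 : ℝ)) x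
      ∂(obsLaw θ) ≤ 8 * (1 / 2 : ℝ) ^ k := by
    intro k _
    rw [integral_const_mul]
    set m := meanExceed θ (xi α n k)
    split_ifs with h
    · have h2 := integral_exceed_le_indicator θ (xi α n k) k
      have hm : 0 ≤ m := meanExceed_nonneg _ _
      -- An eighth of the Chernoff exponent pays for the factor m. What is left, k - m/2, is below
      -- -k since m > 4k; the terms are thus geometric and sum to at most 8.
      have h3 : m ≤ 8 * Real.exp (m / 8) := by linarith [Real.add_one_le_exp (m / 8)]
      calc _ ≤ 8 * Real.exp (m / 8) * Real.exp (k - 5 / 8 * m) :=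
            mul_le_mul h3 h2 (integral_nonneg fun x =>
              Set.indicator_nonneg (fun _ _ => zero_le_one) x) (by positivity)
        _ = 8 * Real.exp (m / 8 + (k - 5 / 8 * m)) := by rw [mul_assoc, ← Real.exp_add]
        _ ≤ 8 * Real.exp (k * (-1)) := by
            gcongr
            linarith
        _ ≤ _ := by
            rw [Real.exp_nat_mul]
            gcongr
            linarith [Real.exp_neg_one_lt_d9]
    · rw [zero_mul]; positivity
  have h2 := Finset.sum_le_sum h1
  rw [← Finset.mul_sum] at h2
  have h3 := sum_half_pow_le n
  simp only [integral_const, probReal_univ, one_smul]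
  linarith

/-! ### Pointwise error of smooth thresholding. -/

namespace IsSmoothThreshold

variable {kappa0 kappa1 : ℝ} {t : ℝ → ℝ → ℝ}

lemma eq_zero_of_abs_le (ht : IsSmoothThreshold kappa0 kappa1 t) {lam x : ℝ} (hx : |x| ≤ lam) :
    t lam x = 0 := by
  have hl : 0 ≤ lam := (abs_nonneg x).trans hx
  have hs : soft lam x = 0 := by simp [soft, hx]
  have hh : hard lam x = 0 := by simp [hard, hx]
  rcases le_or_gt 0 x with h | h
  · obtain ⟨h1, h2⟩ := ht.between_nonneg lam x hl h
    linarith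
  · obtain ⟨h1, h2⟩ := ht.between_neg lam x hl h
    linarith

/-- The function t_λ vanishes at ±λ and has Lipschitz constant κ₀ < 2, so beyond ±λ it grows at most
twice as fast as soft thresholding. -/
lemma abs_le_two_mul_soft (ht : IsSmoothThreshold kappa0 kappa1 t) {lam : ℝ} (hl : 0 ≤ lam)
    (x : ℝ) : |t lam x| ≤ 2 * |soft lam x| := by
  rw [abs_soft hl]
  rcases le_or_gt |x| lam with h | h
  · rw [ht.eq_zero_of_abs_le h, abs_zero]; positivity
  have hk := ht.kappa0_lt_two
  rw [max_eq_left (by linarith)]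
  rcases le_or_gt 0 x with hx | hx
  · rw [abs_of_nonneg hx] at h ⊢
    have h0 : t lam lam = 0 := ht.eq_zero_of_abs_le (abs_of_nonneg hl).le
    obtain ⟨h1, h2⟩ := ht.lipschitz_obs lam lam x hl h
    rw [h0, sub_zero] at h1 h2
    rw [abs_of_nonneg h1]
    nlinarith
  · rw [abs_of_neg hx] at h ⊢
    have h0 : t lam (-lam) = 0 := ht.eq_zero_of_abs_le (by rw [abs_neg, abs_of_nonneg hl])
    obtain ⟨h1, h2⟩ := ht.lipschitz_obs lam x (-lam) hl (by linarith)
    rw [h0, zero_sub] at h1 h2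
    rw [abs_of_nonpos (by linarith)]
    nlinarith

lemma abs_sub_le (ht : IsSmoothThreshold kappa0 kappa1 t) {lam : ℝ} (hl : 0 ≤ lam) (x : ℝ) :
    |t lam x - x| ≤ lam := by
  rcases le_or_gt |x| lam with h | h
  · rw [ht.eq_zero_of_abs_le h, zero_sub, abs_neg]; exact h
  have hh : hard lam x = x := by simp [hard, h]
  rcases lt_trichotomy x 0 with hx | hx | hx
  · have h1 := ht.between_neg lam x hl hx
    rw [hh, soft, Real.sign_of_neg hx, max_eq_left (by linarith), abs_of_neg hx] at h1
    rw [abs_le]; constructor <;> linarith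
  · rw [hx, abs_zero] at h; linarith
  · have h1 := ht.between_nonneg lam x hl hx.le
    rw [hh, soft, Real.sign_of_pos hx, max_eq_left (by linarith), abs_of_pos hx] at h1
    rw [abs_le]; constructor <;> linarith

/-- The increment t_λ(u+z) - t_λ(z) lies between 0 and κ₀u. As κ₀ < 2, it differs from u by at most
|u|. -/
lemma abs_add_sub_le (ht : IsSmoothThreshold kappa0 kappa1 t) {lam : ℝ} (hl : 0 ≤ lam) (u z : ℝ) :
    |t lam (u + z) - u| ≤ |u| + |t lam z| := by
  have hk := ht.kappa0_lt_two
  have key : |t lam (u + z) - t lam z - u| ≤ |u| := by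
    rcases lt_trichotomy u 0 with hu | hu | hu
    · obtain ⟨h1, h2⟩ := ht.lipschitz_obs lam (u + z) z hl (by linarith)
      have h3 : kappa0 * (z - (u + z)) ≤ 2 * (-u) := by nlinarith
      rw [abs_of_neg hu, abs_le]; constructor <;> linarith
    · simp [hu]
    · obtain ⟨h1, h2⟩ := ht.lipschitz_obs lam z (u + z) hl (by linarith)
      have h3 : kappa0 * (u + z - z) ≤ 2 * u := by nlinarith
      rw [abs_of_pos hu, abs_le]; constructor <;> linarith
  calc _ = |(t lam (u + z) - t lam z - u) + t lam z| := by ring_nf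
    _ ≤ _ := (abs_add_le _ _).trans (by linarith)

/-- For |u| ≤ B, compare with t_λ(x-u), which is controlled by soft-thresholded noise. For |u| > B,
use |t_λ(x) - x| ≤ λ ≤ B and pay the full noise, which b ≤ B confines to coordinates with |u| > b.
The level may depend on x: nothing here is averaged. -/
lemma abs_sub_mean_le (ht : IsSmoothThreshold kappa0 kappa1 t) {lam B b : ℝ} (hl : 0 ≤ lam)
    (hB : lam ≤ B) (hb : b ≤ B) (u x : ℝ) :
    |t lam x - u| ≤ min |u| B + (2 * |soft lam (x - u)| + if b < |u| then |x - u| else 0) := by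
  have hs := abs_nonneg (soft lam (x - u))
  have hz := abs_nonneg (x - u)
  rcases le_or_gt |u| B with h | h
  · rw [min_eq_left h]
    have h1 := ht.abs_add_sub_le hl u (x - u)
    rw [add_sub_cancel] at h1
    have h2 := ht.abs_le_two_mul_soft hl (x - u)
    have h3 : 0 ≤ if b < |u| then |x - u| else 0 := by split_ifs <;> linarith
    linarith
  · rw [min_eq_right h.le, if_pos (hb.trans_lt h)]
    have h1 := ht.abs_sub_le hl x
    have h2 : |t lam x - u| ≤ |t lam x - x| + |x - u| := _root_.abs_sub_le _ _ _
    linarith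

lemma sqError_le (ht : IsSmoothThreshold kappa0 kappa1 t) {n : ℕ} (x θ : Fin n → ℝ)
    {lm lam B b e : ℝ} (hlm : 0 ≤ lm) (hl : lm ≤ lam) (hB : lam ≤ B) (hb : b ≤ B) (he : 0 < e) :
    sqError t lam x θ ≤ (1 + e) * ∑ i, min (θ i ^ 2) (B ^ 2) +
      (1 + 1 / e) * (8 * ∑ i, soft lm (x i - θ i) ^ 2 +
        2 * ∑ i, if b < |θ i| then (x i - θ i) ^ 2 else 0) := by
  rw [sqError, Finset.mul_sum, Finset.mul_sum, Finset.mul_sum, ← Finset.sum_add_distrib,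
    Finset.mul_sum, ← Finset.sum_add_distrib]
  refine Finset.sum_le_sum fun i _ => ?_
  have hl0 := hlm.trans hl
  have h1 := ht.abs_sub_mean_le hl0 hB hb (θ i) (x i)
  set p := min |θ i| B
  set s := |soft lam (x i - θ i)|
  set v := if b < |θ i| then |x i - θ i| else 0 with hv
  have hp : 0 ≤ p := le_min (abs_nonneg _) (hl0.trans hB)
  have hs : 0 ≤ s := abs_nonneg _
  have hv0 : 0 ≤ v := by rw [hv]; split_ifs; exacts [abs_nonneg _, le_rfl]
  have hp2 : p ^ 2 ≤ min (θ i ^ 2) (B ^ 2) := by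
    rw [← sq_abs (θ i)]
    exact le_min (by gcongr; exact min_le_left _ _) (by gcongr; exact min_le_right _ _)
  have hs2 : s ^ 2 ≤ soft lm (x i - θ i) ^ 2 := by
    rw [sq_abs]; exact soft_sq_anti hlm hl _
  have hv2 : v ^ 2 = if b < |θ i| then (x i - θ i) ^ 2 else 0 := by
    rw [hv]; split_ifs
    · exact sq_abs _
    · norm_num
  rw [← hv2]
  have h2 : (t lam (x i) - θ i) ^ 2 ≤ (p + (2 * s + v)) ^ 2 := by
    rw [← sq_abs]
    gcongr
  have h3 : (p + (2 * s + v)) ^ 2 ≤ (1 + e) * p ^ 2 + (1 + 1 / e) * (2 * s + v) ^ 2 := by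
    have h4 : 0 ≤ (e * p - (2 * s + v)) ^ 2 / e := by positivity
    have h5 : (e * p - (2 * s + v)) ^ 2 / e =
        e * p ^ 2 - 2 * p * (2 * s + v) + 1 / e * (2 * s + v) ^ 2 := by
      field_simp
      ring
    nlinarith
  have h6 : (2 * s + v) ^ 2 ≤ 8 * soft lm (x i - θ i) ^ 2 + 2 * v ^ 2 := by
    nlinarith [sq_nonneg (2 * s - v)]
  refine h2.trans (h3.trans (add_le_add ?_ ?_)) <;> gcongr

/-- A Carathéodory function, Lipschitz in the level and monotone in the observation. Clipping the
level at 0 is needed because regularity is assumed for nonnegative levels only. -/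
lemma measurable_uncurry (ht : IsSmoothThreshold kappa0 kappa1 t) :
    Measurable (Function.uncurry fun lam x => t (max lam 0) x) := by
  refine measurable_uncurry_of_continuous_of_measurable (fun x => ?_) fun lam => ?_
  · refine (LipschitzWith.of_dist_le_mul (K := kappa1.toNNReal) fun a b => ?_).continuous
    rw [Real.dist_eq, Real.dist_eq]
    refine (ht.lipschitz_level _ _ x (le_max_right a 0) (le_max_right b 0)).trans ?_
    rw [Real.coe_toNNReal']
    exact mul_le_mul (le_max_left _ _) (abs_max_sub_max_le_abs _ _ _) (abs_nonneg _)
      (le_max_right _ _)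
  · refine Monotone.measurable fun x y hxy => ?_
    rcases hxy.eq_or_lt with rfl | h
    · exact le_rfl
    · linarith [(ht.lipschitz_obs (max lam 0) x y (le_max_right _ _) h).1]

end IsSmoothThreshold

/-! ### Assembling the noise, signal and bias bounds. -/

lemma sqrt_le_sqrt_add_sqrt_of_forall {V a b : ℝ} (ha : 0 ≤ a) (hb : 0 ≤ b)
    (h : ∀ e : ℝ, 0 < e → V ≤ (1 + e) * a + (1 + 1 / e) * b) : √V ≤ √a + √b := by
  rw [Real.sqrt_le_left (by positivity), add_sq, Real.sq_sqrt ha, Real.sq_sqrt hb]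
  refine le_of_forall_pos_le_add fun d hd => ?_
  set p := √a
  set q := √b
  have hp : 0 ≤ p := Real.sqrt_nonneg _
  have hq : 0 ≤ q := Real.sqrt_nonneg _
  have ea : a = p ^ 2 := (Real.sq_sqrt ha).symm
  have eb : b = q ^ 2 := (Real.sq_sqrt hb).symm
  -- perturb both roots to make the optimal weight `q / p` well defined
  set r := d / (2 * (p + q + 1)) with hr
  have hr0 : 0 < r := by positivity
  have h1 := h ((q + r) / (p + r)) (by positivity)
  have h2 : (q + r) / (p + r) * p ^ 2 ≤ (q + r) * p := by
    rw [div_mul_eq_mul_div, div_le_iff₀ (by positivity)]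
    nlinarith [mul_nonneg (mul_nonneg hr0.le (by linarith : 0 ≤ q + r)) hp]
  have h3 : 1 / ((q + r) / (p + r)) * q ^ 2 ≤ (p + r) * q := by
    rw [one_div_div, div_mul_eq_mul_div, div_le_iff₀ (by positivity)]
    nlinarith [mul_nonneg (mul_nonneg hr0.le (by linarith : 0 ≤ p + r)) hq]
  have h4 : r * (p + q) ≤ d := by
    rw [hr, div_mul_eq_mul_div, div_le_iff₀ (by positivity)]
    nlinarith
  rw [ea, eb] at h1 ⊢
  linarith

lemma LevelCondition.monotoneOn {M0 c1 c2 : ℝ} {g : ℝ → ℝ} (hg : LevelCondition M0 c1 c2 g) :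
    MonotoneOn g (Set.Ioi 0) := by
  refine monotoneOn_of_deriv_nonneg (convex_Ioi 0)
    (fun x hx => (hg.differentiableAt x hx).continuousAt.continuousWithinAt) ?_ ?_
  · rw [interior_Ioi]
    exact fun x hx => (hg.differentiableAt x hx).differentiableWithinAt
  · rw [interior_Ioi]
    exact fun x hx => hg.deriv_nonneg x hx

lemma sqrt_add_le {a b : ℝ} (ha : 0 ≤ a) (hb : 0 ≤ b) : √(a + b) ≤ √a + √b := by
  rw [Real.sqrt_le_left (by positivity), add_sq, Real.sq_sqrt ha, Real.sq_sqrt hb]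
  have : 0 ≤ 2 * √a * √b := by positivity
  linarith

lemma one_div_L1_le_tau1 (n : ℕ) (η c1 c2 : ℝ) : 1 / L1 η ≤ tau1 n η c1 c2 := le_max_right _ _

lemma weight_le_tau1 (n : ℕ) (η c1 c2 : ℝ) : weight c1 c2 (L1 η) ≤ tau1 n η c1 c2 :=
  (le_max_right _ _).trans (le_max_left _ _)

lemma tau1_pos (n : ℕ) (η c1 c2 : ℝ) : 0 < tau1 n η c1 c2 :=
  (one_div_pos.2 (L1_pos η)).trans_le (one_div_L1_le_tau1 n η c1 c2)

lemma integrable_sub_sq_eval {n : ℕ} (θ : Fin n → ℝ) (i : Fin n) :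
    Integrable (fun x : Fin n → ℝ => (x i - θ i) ^ 2) (obsLaw θ) :=
  integrable_comp_eval θ i (f := fun y => (y - θ i) ^ 2) (integrable_sub_sq (θ i))

lemma integral_sub_sq_eval {n : ℕ} (θ : Fin n → ℝ) (i : Fin n) :
    ∫ x : Fin n → ℝ, (x i - θ i) ^ 2 ∂(obsLaw θ) = 1 := by
  rw [integral_comp_eval θ i (f := fun y => (y - θ i) ^ 2) (integrable_sub_sq (θ i)),
    integral_sub_sq]

lemma xiHat1_pos {α : ℝ} (h0 : 0 < α) (h1 : α < 1) {n : ℕ} (hn : 1 ≤ n) (x : Fin n → ℝ) :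
    0 < xiHat1 α x := by
  obtain ⟨k, hk, hkn, -, e⟩ := xiHat1_mem α hn x
  rw [e]; exact xi_pos h0 h1 hk hkn

/-- The noise left above the random lower level has the order of the remainder terms. -/
lemma exists_noise_majorant (α1' α2' A M0 : ℝ) (hα2' : 0 < α2') (hα1' : α1' < 1) (hA : 0 ≤ A) :
    ∃ C : ℝ, 0 < C ∧ ∀ (α : ℝ) (n : ℕ) (δ c1 c2 : ℝ) (g : ℝ → ℝ) (θ : Fin n → ℝ) (η ε : ℝ),
      α2' < α → α < α1' → 2 ≤ n → 0 ≤ δ → δ ≤ A → LevelCondition M0 c1 c2 g → 0 ≤ η →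
      ε ≤ 1 / n → (0 < η → ε ≤ η) →
      (η ≤ 1 / 8 → ∑ i, min (θ i ^ 2) 1 ≤ n * (η + ε)) →
      ∃ F : (Fin n → ℝ) → ℝ, Integrable F (obsLaw θ) ∧
        (∀ x, ∑ i, soft (√(1 + δ) * g (xiHat1 α x)) (x i - θ i) ^ 2 ≤ F x) ∧
        ∫ x, F x ∂(obsLaw θ) ≤ C * (n * (tau1 n η c1 c2 * η + tau2 n δ c1 c2)) := by
  rcases le_or_gt α1' 0 with hneg | hα1'0
  · exact ⟨1, one_pos, fun α n δ c1 c2 g θ η ε h1 h2 => by linarith⟩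
  obtain ⟨D1, hD1, hR1⟩ := softRisk_level_xi_le α2' M0 hα2'
  obtain ⟨D2, hD2, hR2⟩ := softRisk_sqrt_level_xi_le α2' A M0 hα2'
  obtain ⟨C, hC, hgrow⟩ :=
    integral_noiseMajorant_le_of_growth α1' hα1'0 hα1' ⌈(M0 + 2) * (1 + A)⌉₊
  have he := Real.exp_pos 1
  refine ⟨8 * Real.exp 1 + C * D1 + C * D2, by positivity,
    fun α n δ c1 c2 g θ η ε hα hαα hn hδ hδA hg hη hεn hεη hθ => ?_⟩
  have hn1 : 1 ≤ n := by omega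
  have hn0 : (0 : ℝ) < n := by exact_mod_cast hn1
  have hn1' : (1 : ℝ) ≤ n := by exact_mod_cast hn1
  have hα0 : 0 < α := hα2'.trans hα
  have hα1 : α < 1 := hαα.trans hα1'
  have hM0 : 0 ≤ M0 := (abs_nonneg c2).trans hg.abs_c2_le
  have hs1 : 1 ≤ √(1 + δ) := Real.one_le_sqrt.2 (by linarith)
  have hτ1 := tau1_pos n η c1 c2
  have hτ2 := tau2_pos hn (c1 := c1) (c2 := c2) hδ
  set τ1 := tau1 n η c1 c2
  set τ2 := tau2 n δ c1 c2
  have hτη : 0 ≤ τ1 * η := by positivity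
  set l : ℕ → ℝ := fun k => √(1 + δ) * g (xi α n k)
  have hlg : ∀ k, 1 ≤ k → k ≤ n → 0 ≤ g (xi α n k) := fun k hk hkn =>
    hg.nonneg _ (xi_pos hα0 hα1 hk hkn)
  have hl : ∀ k, 1 ≤ k → k ≤ n → 0 ≤ l k := fun k hk hkn =>
    mul_nonneg (by positivity) (hlg k hk hkn)
  have hanti : ∀ j k, 1 ≤ j → j ≤ k → k ≤ n → l k ≤ l j := fun j k hj hjk hkn =>
    mul_le_mul_of_nonneg_left (hg.monotoneOn (xi_pos hα0 hα1 (hj.trans hjk) hkn)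
      (xi_pos hα0 hα1 hj (hjk.trans hkn)) (xi_anti hα0 hα1 hj hjk (by omega))) (by positivity)
  rcases lt_or_ge (1 / 8) η with h8 | h8
  -- When η > 1/8, `L1 η` = e keeps τ₁η bounded below, so the unthresholded noise, of mean n, is
  -- already small enough.
  · refine ⟨fun x => ∑ i, (x i - θ i) ^ 2,
      integrable_finsetSum _ fun i _ => integrable_sub_sq_eval θ i, fun x => ?_, ?_⟩
    · exact Finset.sum_le_sum fun i _ => soft_sq_le
        (mul_nonneg (by positivity) (hg.nonneg _ (xiHat1_pos hα0 hα1 hn1 x))) _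
    · rw [integral_finsetSum _ fun i _ => integrable_sub_sq_eval θ i]
      simp only [integral_sub_sq_eval, Finset.sum_const, Finset.card_univ, Fintype.card_fin,
        nsmul_eq_mul, mul_one]
      have h1 : 1 / Real.exp 1 ≤ τ1 := by
        rw [← L1_eq_exp_one h8.le]; exact one_div_L1_le_tau1 n η c1 c2
      have h2 : 1 ≤ 8 * Real.exp 1 * (τ1 * η) := by
        rw [div_le_iff₀ he] at h1
        nlinarith [mul_pos hτ1 he]
      calc (n : ℝ) ≤ n * (8 * Real.exp 1 * (τ1 * η)) := le_mul_of_one_le_right hn0.le h2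
        _ = 8 * Real.exp 1 * (n * (τ1 * η)) := by ring
        _ ≤ _ := by
          gcongr
          · have : 0 ≤ C * D1 + C * D2 := by positivity
            linarith
          · linarith
  -- The scale is y = η ∨ 1/n, and nD/n is the noise budget at index about ny; the Chernoff argument
  -- needs ny ≥ 1.
  suffices h : ∃ y D : ℝ, 1 ≤ n * y ∧ y ≤ 1 ∧ 0 ≤ D ∧ ∑ i, min (θ i ^ 2) 1 ≤ 2 * (n * y) ∧
      (∀ k : ℕ, 1 ≤ k → k ≤ n → n * y ≤ k →
        n * softRisk 0 (l k) ≤ D * (k / (n * y)) ^ ⌈(M0 + 2) * (1 + A)⌉₊) ∧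
      D ≤ (D1 + D2) * (n * (τ1 * η + τ2)) by
    obtain ⟨y, D, h1, h2, h3, h4, h5, h6⟩ := h
    obtain ⟨k0, hk0, hk0n, hint⟩ := hgrow n θ α y D l hn1 hα0 hαα h1 h2 h3 hl h4 h5
    refine ⟨noiseMajorant θ α l k0, integrable_noiseMajorant θ α hl hk0 hk0n, fun x => ?_, ?_⟩
    · obtain ⟨k, hk, hkn, hx, e⟩ := xiHat1_mem α hn1 x
      rw [e]
      exact sum_soft_le_noiseMajorant θ α hl hanti hk0 hk0n hk hkn hx
    · refine hint.trans ?_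
      calc _ ≤ C * ((D1 + D2) * (n * (τ1 * η + τ2))) := by gcongr
        _ = (C * D1 + C * D2) * (n * (τ1 * η + τ2)) := by ring
        _ ≤ _ := by
          gcongr
          linarith
  rcases le_or_gt (1 / (n : ℝ)) η with hηn | hηn
  · have hη0 : 0 < η := lt_of_lt_of_le (by positivity) hηn
    have hnη : 1 ≤ n * η := by rwa [div_le_iff₀' hn0] at hηn
    have hw := weight_pos (c1 := c1) (c2 := c2) (le_max_left (Real.exp 1) (Real.log (1 / η)))
    refine ⟨η, n * (D1 * η * weight c1 c2 (L1 η)), hnη, by linarith,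
      mul_nonneg hn0.le (mul_nonneg (by positivity) hw.le), ?_, fun k hk hkn hnk => ?_, ?_⟩
    · have := hεη hη0
      refine (hθ h8).trans ?_
      nlinarith
    · have h1 := hR1 c1 c2 g hg α n k η hα hα1 hk hkn hη0 (by linarith) hnk
      -- For η ≥ 1/n the factor √(1+δ) is simply discarded.
      have h2 : softRisk 0 (l k) ≤ softRisk 0 (g (xi α n k)) :=
        softRisk_zero_anti (hlg k hk hkn) (le_mul_of_one_le_left (hlg k hk hkn) hs1)
      have hq : 1 ≤ k / (n * η) := by rw [one_le_div (by linarith)]; exact hnk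
      have h3 : (k / (n * η)) ^ (M0 + 2) ≤ (k / (n * η)) ^ ⌈(M0 + 2) * (1 + A)⌉₊ := by
        rw [← Real.rpow_natCast]
        refine Real.rpow_le_rpow_of_exponent_le hq (le_trans ?_ (Nat.le_ceil _))
        nlinarith
      calc _ ≤ n * (D1 * η * (k / (n * η)) ^ (M0 + 2) * weight c1 c2 (L1 η)) := by
            gcongr
            exact h2.trans h1
        _ ≤ n * (D1 * η * (k / (n * η)) ^ ⌈(M0 + 2) * (1 + A)⌉₊ * weight c1 c2 (L1 η)) := by
            have : 0 ≤ weight c1 c2 (L1 η) := hw.le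
            gcongr
        _ = _ := by ring
    · have h1 : weight c1 c2 (L1 η) ≤ τ1 := weight_le_tau1 n η c1 c2
      calc _ ≤ n * (D1 * η * τ1) := by gcongr
        _ = D1 * (n * (τ1 * η)) := by ring
        _ ≤ _ := by gcongr <;> linarith
  · have hny : (n : ℝ) * (1 / n) = 1 := mul_one_div_cancel hn0.ne'
    refine ⟨1 / n, n * (D2 * τ2), hny.ge, ?_, by positivity, ?_, fun k hk hkn hnk => ?_, ?_⟩
    · rw [div_le_one hn0]; exact hn1'
    · refine (hθ h8).trans ?_
      rw [hny]
      have h1 : n * η ≤ n * (1 / n) := by gcongr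
      have h2 : n * ε ≤ n * (1 / n) := by gcongr
      linarith
    · have h1 := hR2 δ c1 c2 g hδ hδA hg α n k hα hα1 hn hk hkn
      have hk1 : (1 : ℝ) ≤ k := by exact_mod_cast hk
      have h3 : (k : ℝ) ^ ((M0 + 2) * (1 + A)) ≤ (k : ℝ) ^ ⌈(M0 + 2) * (1 + A)⌉₊ := by
        rw [← Real.rpow_natCast]
        exact Real.rpow_le_rpow_of_exponent_le hk1 (Nat.le_ceil _)
      rw [hny, div_one]
      calc _ ≤ n * (D2 * τ2 * (k : ℝ) ^ ((M0 + 2) * (1 + A))) := by gcongr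
        _ ≤ n * (D2 * τ2 * (k : ℝ) ^ ⌈(M0 + 2) * (1 + A)⌉₊) := by gcongr
        _ = _ := by ring
    · calc _ = D2 * (n * τ2) := by ring
        _ ≤ _ := by gcongr <;> linarith

end FDRThreshold

end

/-! ### The oracle inequality. -/

open MeasureTheory ProbabilityTheory FDRThreshold
theorem theorem5 (α1' α2' β0 A M0 : ℝ)
    (hα2' : 0 < α2') (hα1' : α1' < 1) (hβ0 : 0 < β0) (hβ0' : β0 ≤ 1 / 2) (hA : 0 < A) :
    ∃ M : ℝ, 0 < M ∧
      ∀ (α1 α2 : ℝ), α2' < α2 → α2 ≤ α1 → α1 < α1' →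
      ∀ (n : ℕ), 2 ≤ n →
      ∀ (δ1 δ2 : ℝ), 0 ≤ δ1 → δ1 ≤ min δ2 A →
        ((n : ℕ∞) < nStar β0 α1' → 1 + δ2 ≤ A) →
      ∀ (c1 c2 : ℝ) (g : ℝ → ℝ), LevelCondition M0 c1 c2 g →
      ∀ (kappa0 kappa1 : ℝ) (t : ℝ → ℝ → ℝ), IsSmoothThreshold kappa0 kappa1 t →
      ∀ (θ : Fin n → ℝ) (Ω : Type*) [MeasurableSpace Ω] (P : Measure Ω) [IsProbabilityMeasure P]
        (X : Ω → Fin n → ℝ) (lamHat : Ω → ℝ),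
        HasLaw X (Measure.pi fun i => gaussianReal (θ i) 1) P →
        AEMeasurable lamHat P →
        (∀ᵐ ω ∂P, Real.sqrt (1 + δ1) * g (xiHat1 α1 (X ω)) ≤ lamHat ω ∧
          lamHat ω ≤ Real.sqrt (1 + δ2) * xiHat2 α2 (X ω)) →
      ∀ (η : ℝ),
        η = etaStar (max (8 / α2') (2 * (kappa0 / (2 - kappa0)) ^ 2)) (empPrior θ) →
        Integrable (fun ω => sqError t (lamHat ω) (X ω) θ) P ∧
        Real.sqrt ((∫ ω, sqError t (lamHat ω) (X ω) θ ∂P) / n) ≤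
          Real.sqrt ((1 + δ2) * η) +
            M * Real.sqrt ((1 + δ2) * tau1 n η c1 c2 * η + tau2 n δ1 c1 c2) := by
  obtain ⟨Cm, hCm, hnear⟩ := exists_near_minimizer
  obtain ⟨Cn, hCn, hnoise⟩ := exists_noise_majorant α1' α2' A M0 hα2' hα1' hA.le
  set K1 : ℝ := 1 + 96 / α2' * Cm with hK1
  set K2 : ℝ := 8 * Cn + 2 * Cm with hK2
  refine ⟨√K1 + √K2, by positivity, ?_⟩
  intro α1 α2 hα2 hα21 hα1 n hn δ1 δ2 hδ1 hδ12 _ c1 c2 g hg kappa0 kappa1 t ht θ Ω _ P _ X lamHat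
    hX hlamHat hbounds η hη
  have hn1 : 1 ≤ n := by omega
  have hn0 : (0 : ℝ) < n := by exact_mod_cast hn1
  have hα20 : 0 < α2 := hα2'.trans hα2
  have hα11 : α1 < 1 := hα1.trans hα1'
  have hα10 : 0 < α1 := hα20.trans_le hα21
  have hδ2 : 0 ≤ δ2 := hδ1.trans (hδ12.trans (min_le_left _ _))
  have hδA : δ1 ≤ A := hδ12.trans (min_le_right _ _)
  have hB0 : 8 ≤ max (8 / α2') (2 * (kappa0 / (2 - kappa0)) ^ 2) := by
    refine le_max_of_le_left ?_
    rw [le_div_iff₀ hα2']; linarith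
  have hη0 : 0 ≤ η := hη ▸ etaStar_nonneg (by linarith) _
  have hτ1 := tau1_pos n η c1 c2
  have hτ1L := one_div_L1_le_tau1 n η c1 c2
  have hτ2 := tau2_pos hn (c1 := c1) (c2 := c2) hδ1
  set τ1 := tau1 n η c1 c2
  set τ2 := tau2 n δ1 c1 c2
  -- The infimum over finite levels need not be attained, for instance at θ = 0. The slack ε is
  -- chosen small enough to be absorbed into τ₂, and below η when η > 0.
  obtain ⟨ε, hε, hε8, hεn, hετ, hεη⟩ : ∃ ε : ℝ, 0 < ε ∧ ε ≤ 1 / 8 ∧ ε ≤ 1 / n ∧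
      (1 + δ2) * ε ≤ τ2 ∧ (0 < η → ε ≤ η) := by
    refine ⟨min (min (1 / 8) (1 / n)) (min (τ2 / (1 + δ2)) (if 0 < η then η else 1)), ?_,
      (min_le_left _ _).trans (min_le_left _ _), (min_le_left _ _).trans (min_le_right _ _), ?_,
      fun h => ?_⟩
    · refine lt_min (lt_min (by norm_num) (by positivity)) (lt_min (by positivity) ?_)
      split_ifs with h
      exacts [h, one_pos]
    · rw [← le_div_iff₀' (by linarith)]
      exact (min_le_right _ _).trans (min_le_left _ _)
    · refine (min_le_right _ _).trans ((min_le_right _ _).trans ?_)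
      rw [if_pos h]
  obtain ⟨lam, hlam, hrho, hsmall, hPhi, hsig⟩ :=
    hnear n θ _ η ε hn1 hB0 hη hε hε8 hεη
  obtain ⟨F, hFint, hFle, hFI⟩ :=
    hnoise α1 n δ1 c1 c2 g θ η ε (hα2.trans_le hα21) hα1 hn hδ1 hδA hg hη0 hεn hεη hsmall
  have hs1 : 1 ≤ √(1 + δ2) := Real.one_le_sqrt.2 (by linarith)
  set S : (Fin n → ℝ) → ℝ := fun x => ∑ i, if lam < |θ i| then (x i - θ i) ^ 2 else 0
  have hSi : ∀ i ∈ Finset.univ, Integrable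
      (fun x : Fin n → ℝ => if lam < |θ i| then (x i - θ i) ^ 2 else 0) (obsLaw θ) := fun i _ => by
    split_ifs
    exacts [integrable_sub_sq_eval θ i, integrable_zero _ _ _]
  have hSint : Integrable S (obsLaw θ) := integrable_finsetSum _ hSi
  have hSI : ∫ x, S x ∂(obsLaw θ) = signalCount θ lam := by
    rw [integral_finsetSum _ hSi, signalCount]
    refine Finset.sum_congr rfl fun i _ => ?_
    split_ifs
    exacts [integral_sub_sq_eval θ i, integral_zero _ _]
  set H : (Fin n → ℝ) → ℝ := fun x => (1 + δ2) * (n * rho (empPrior θ) lam +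
    8 * n / α2 * Phi (-lam) * biasMajorant θ α2 x) with hH
  have hHint : Integrable H (obsLaw θ) :=
    ((integrable_const _).add ((integrable_biasMajorant θ α2).const_mul _)).const_mul _
  set G : ℝ → (Fin n → ℝ) → ℝ := fun e x => (1 + e) * H x + (1 + 1 / e) * (8 * F x + 2 * S x)
  have hGint : ∀ e, Integrable (G e) (obsLaw θ) := fun e =>
    (hHint.const_mul _).add (((hFint.const_mul 8).add (hSint.const_mul 2)).const_mul _)
  have hpt : ∀ e : ℝ, 0 < e → ∀ᵐ ω ∂P, sqError t (lamHat ω) (X ω) θ ≤ G e (X ω) := by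
    intro e he
    filter_upwards [hbounds] with ω hω
    have hlm : 0 ≤ √(1 + δ1) * g (xiHat1 α1 (X ω)) :=
      mul_nonneg (by positivity) (hg.nonneg _ (xiHat1_pos hα10 hα11 hn1 _))
    set m := max lam (xiHat2 α2 (X ω)) with hm
    have hm0 : 0 ≤ m := hlam.trans (le_max_left _ _)
    -- The cap B = √(1+δ₂) max(lam, ξ̂₂) dominates both the random level and lam, while the signal
    -- cutoff b = lam is deterministic, so that the signal term has mean `signalCount θ lam`.
    refine (ht.sqError_le (X ω) θ (B := √(1 + δ2) * m) (b := lam) hlm hω.1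
      (hω.2.trans (by gcongr; exact le_max_right _ _))
      ((le_max_left _ _).trans (le_mul_of_one_le_left hm0 hs1)) he).trans ?_
    have h1 : ∑ i, min (θ i ^ 2) ((√(1 + δ2) * m) ^ 2) ≤ H (X ω) := by
      calc _ ≤ ∑ i, (1 + δ2) * min (θ i ^ 2) (m ^ 2) := by
            refine Finset.sum_le_sum fun i _ => ?_
            rw [mul_pow, Real.sq_sqrt (by linarith), mul_min_of_nonneg _ _ (by linarith)]
            exact min_le_min_right _ (le_mul_of_one_le_left (sq_nonneg _) (by linarith))
        _ ≤ _ := by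
            rw [← Finset.mul_sum]
            exact mul_le_mul_of_nonneg_left
              (sum_min_sq_max_le hn1 θ hα20 (hα21.trans_lt hα11) hlam (X ω)) (by linarith)
    have h2 := hFle (X ω)
    have h3 : 0 ≤ 1 + 1 / e := by positivity
    exact add_le_add (mul_le_mul_of_nonneg_left h1 (by linarith)) (mul_le_mul_of_nonneg_left
      (add_le_add (mul_le_mul_of_nonneg_left h2 (by norm_num)) le_rfl) h3)
  have hnn : ∀ ω, 0 ≤ sqError t (lamHat ω) (X ω) θ := fun ω =>
    Finset.sum_nonneg fun i _ => sq_nonneg _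
  have hmeas : AEStronglyMeasurable (fun ω => sqError t (lamHat ω) (X ω) θ) P := by
    have h1 : AEMeasurable (fun ω => sqError t (max (lamHat ω) 0) (X ω) θ) P := by
      unfold sqError
      refine Finset.aemeasurable_fun_sum _ fun i _ => AEMeasurable.pow_const (AEMeasurable.sub_const ?_ _) 2
      exact ht.measurable_uncurry.comp_aemeasurable
        (hlamHat.prodMk ((measurable_pi_apply i).comp_aemeasurable hX.aemeasurable))
    refine (h1.congr ?_).aestronglyMeasurable
    filter_upwards [hbounds] with ω hω
    have hlm : 0 ≤ √(1 + δ1) * g (xiHat1 α1 (X ω)) :=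
      mul_nonneg (by positivity) (hg.nonneg _ (xiHat1_pos hα10 hα11 hn1 _))
    rw [max_eq_left (hlm.trans hω.1)]
  have hGX : ∀ e, Integrable (fun ω => G e (X ω)) P := fun e => by
    have h1 := hGint e
    rw [obsLaw, ← hX.map_eq] at h1
    exact h1.comp_aemeasurable hX.aemeasurable
  have hGXI : ∀ e, ∫ ω, G e (X ω) ∂P = ∫ x, G e x ∂(obsLaw θ) := fun e =>
    hX.integral_comp (hGint e).1
  have hint : Integrable (fun ω => sqError t (lamHat ω) (X ω) θ) P := by
    refine (hGX 1).mono' hmeas ?_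
    filter_upwards [hpt 1 one_pos] with ω hω
    rwa [Real.norm_of_nonneg (hnn ω)]
  refine ⟨hint, ?_⟩
  have hL := L1_pos η
  have hratio : η / L1 η ≤ τ1 * η := by
    rw [div_eq_mul_one_div, mul_comm]; gcongr
  have hτη : 0 ≤ τ1 * η := by positivity
  set T : ℝ := (1 + δ2) * τ1 * η + τ2 with hT
  have hT1 : (1 + δ2) * (η / L1 η + ε) ≤ T := by
    rw [hT, mul_add, mul_assoc]
    gcongr
  have hT2 : η / L1 η + ε ≤ T := (le_mul_of_one_le_left (by positivity) (by linarith)).trans hT1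
  have hT3 : τ1 * η + τ2 ≤ T := by
    have := mul_nonneg hδ2 hτη
    rw [hT]
    linarith
  have hT0 : 0 ≤ T := (by positivity : 0 ≤ τ1 * η + τ2).trans hT3
  have hHI : ∫ x, H x ∂(obsLaw θ) ≤ n * ((1 + δ2) * η + K1 * T) := by
    have e1 : ∫ x, H x ∂(obsLaw θ) = (1 + δ2) * (n * rho (empPrior θ) lam +
        8 * n / α2 * Phi (-lam) * ∫ x, biasMajorant θ α2 x ∂(obsLaw θ)) := by
      rw [hH, integral_const_mul, integral_add (integrable_const _)
        ((integrable_biasMajorant θ α2).const_mul _)]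
      simp [integral_const_mul]
    have hb := integral_biasMajorant_le θ α2
    have hP := Phi_nonneg (-lam)
    rw [e1]
    calc _ ≤ (1 + δ2) * (n * (η + ε) + 8 * n / α2' * (Cm * (η / L1 η + ε)) * 12) := by
          have hle : 8 * n / α2 ≤ 8 * n / α2' := by gcongr
          have : 8 * n / α2 * Phi (-lam) ≤ 8 * n / α2' * (Cm * (η / L1 η + ε)) := by gcongr
          have h2 : 8 * n / α2 * Phi (-lam) * ∫ x, biasMajorant θ α2 x ∂(obsLaw θ) ≤
              8 * n / α2 * Phi (-lam) * 12 := by gcongr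
          gcongr ?_ * (?_ + ?_)
          · gcongr
          · linarith
      _ = n * ((1 + δ2) * η + ((1 + δ2) * ε + 96 / α2' * Cm * ((1 + δ2) * (η / L1 η + ε)))) := by
          ring
      _ ≤ n * ((1 + δ2) * η + (T + 96 / α2' * Cm * T)) := by
          have : (1 + δ2) * ε ≤ T := hετ.trans (by linarith)
          gcongr
      _ = _ := by rw [hK1]; ring
  have hNI : 8 * ∫ x, F x ∂(obsLaw θ) + 2 * signalCount θ lam ≤ n * (K2 * T) := by
    calc _ ≤ 8 * (Cn * (n * T)) + 2 * (Cm * T * n) := by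
          have h1 : ∫ x, F x ∂(obsLaw θ) ≤ Cn * (n * T) := hFI.trans (by gcongr)
          have h2 : signalCount θ lam ≤ Cm * T * n := hsig.trans (by gcongr)
          linarith
      _ = _ := by rw [hK2]; ring
  have hV : √((∫ ω, sqError t (lamHat ω) (X ω) θ ∂P) / n) ≤
      √((1 + δ2) * η + K1 * T) + √(K2 * T) := by
    -- None of the integrated bounds depends on e, so the weight can be optimized after taking
    -- expectations.
    refine sqrt_le_sqrt_add_sqrt_of_forall (by positivity) (by positivity) fun e he => ?_
    rw [div_le_iff₀ hn0]
    calc _ ≤ ∫ ω, G e (X ω) ∂P := integral_mono_ae hint (hGX e) (hpt e he)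
      _ = (1 + e) * ∫ x, H x ∂(obsLaw θ) + (1 + 1 / e) * (8 * ∫ x, F x ∂(obsLaw θ) +
            2 * signalCount θ lam) := by
          have hi : Integrable (fun x => 8 * F x + 2 * S x) (obsLaw θ) :=
            (hFint.const_mul 8).add (hSint.const_mul 2)
          rw [hGXI]
          change ∫ x, (1 + e) * H x + (1 + 1 / e) * (8 * F x + 2 * S x) ∂(obsLaw θ) = _
          rw [integral_add (hHint.const_mul _) (hi.const_mul _), integral_const_mul (1 + e) H,
            integral_const_mul (1 + 1 / e) fun x => 8 * F x + 2 * S x, integral_add (hFint.const_mul 8) (hSint.const_mul 2),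
            integral_const_mul 8 F, integral_const_mul 2 S, hSI]
      _ ≤ (1 + e) * (n * ((1 + δ2) * η + K1 * T)) + (1 + 1 / e) * (n * (K2 * T)) := by
          gcongr
      _ = _ := by ring
  calc _ ≤ _ := hV
    _ ≤ √((1 + δ2) * η) + √(K1 * T) + √(K2 * T) := by
        gcongr
        exact sqrt_add_le (by positivity) (by positivity)
    _ = _ := by
        rw [Real.sqrt_mul (by positivity : 0 ≤ K1), Real.sqrt_mul (by positivity : 0 ≤ K2)]
        ring
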